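/- For $\kappa\le 0$ let $\rho_\kappa=|\kappa|^{-1/2}$ (with $\rho_0=\infty$), let $\mathbb{U}(0,\rho_\kappa)=\{z\in\mathbb{C}:|z|<\rho_\kappa\}$, and for a complex sequence $\boldsymbol{x}=(x_0,x_1,\dots)$ put $$f_\kappa(\boldsymbol{x},z)=\sum_{n=0}^\infty a_{n,\kappa}x_nz^n,\qquad a_{n,\kappa}=\prod_{j=1}^n\Big[\frac{1-(j-1)\kappa}{j}\Big]^{1/2}.$$ For $u\in\mathbb{U}(0,\rho_\kappa)$ let $\Phi^u_\kappa(z)=\dfrac{z-u}{1+\kappa\bar u z}$, a conformal automorphism of $\mathbb{U}(0,\rho_\kappa)$. **Theorem.** Let $X_0,X_1,\dots$ be i.i.d. complex random variables with $\mathbf{E}X_n=0$, $\mathbf{E}|X_n|^2=1$, $\mathbf{E}[(\mathrm{Re}\,X_n)^2]=\mathbf{E}[(\mathrm{Im}\,X_n)^2]$ and $\mathbf{E}[\mathrm{Re}\,X_n\,\mathrm{Im}\,X_n]=0$. Let $Z_0,Z_1,\dots$ be i.i.d. standard complex Gaussian random variables, i.e. with density $\pi^{-1}e^{-|z|^2}$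 on $\mathbb{C}$. Write $\boldsymbol{X}=(X_n)_{n\ge0}$ and $\boldsymbol{Z}=(Z_n)_{n\ge0}$. Then for each $\kappa\le 0$ and each continuous $\varphi:\mathbb{C}\to\mathbb{C}$ whose support is a compact subset of $\mathbb{U}(0,\rho_\kappa)$, the random variables $$\sum_{\xi\in\mathbb{U}(0,\rho_\kappa):\,f_\kappa(\boldsymbol{X},\xi)=0}\varphi(\Phi^u_\kappa(\xi))$$ converge in distribution, as $|u|\to\rho_\kappa$ with $u\in\mathbb{U}(0,\rho_\kappa)$, to the random variable $$\sum_{\xi\in\mathbb{U}(0,\rho_\kappa):\,f_\kappa(\boldsymbol{Z},\xi)=0}\varphi(\xi),$$ where in both sums every zero is counted with its multiplicity. (Almost surely both functions are analytic and not identically zero on $\mathbb{U}(0,\rho_\kappa)$, so the sums are finite.) -/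

import Mathlib

open MeasureTheory ProbabilityTheory Filter Topology

open scoped ENNReal ComplexConjugate

noncomputable section

namespace RandomAnalytic

/-- The coefficients `a_{n,κ} = ∏_{j=1}^n √((1 - (j-1)κ) / j)`. -/
def coeff (κ : ℝ) (n : ℕ) : ℝ :=
  ∏ j ∈ Finset.Icc 1 n, √((1 - ((j : ℝ) - 1) * κ) / (j : ℝ))

/-- The power series `f_κ(x, z) = ∑_n a_{n,κ} x_n z^n`. -/
def powerSeriesFun (κ : ℝ) (x : ℕ → ℂ) (z : ℂ) : ℂ :=
  ∑' n : ℕ, (coeff κ n : ℂ) * x n * z ^ n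

/-- The radius `ρ_κ = |κ|^{-1/2}`, which is `∞` for `κ = 0`. -/
def radius (κ : ℝ) : ℝ≥0∞ := ENNReal.ofReal |κ| ^ (-(1 / 2) : ℝ)

/-- The open disk of radius `ρ_κ` about `0` (the whole plane for `κ = 0`). -/
def disk (κ : ℝ) : Set ℂ := {z : ℂ | ‖z‖ₑ < radius κ}

/-- The Möbius transformation `Φ_κ^u(z) = (z - u) / (1 + κ ū z)`. -/
def mobius (κ : ℝ) (u z : ℂ) : ℂ := (z - u) / (1 + (κ : ℂ) * conj u * z)

/-- The sum of `ψ(ξ)` over the zeros `ξ` of `f_κ(x, ·)` in the disk of radius `ρ_κ`, each zero being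
counted with its multiplicity. When `f_κ(x, ·)` is analytic on the disk and not identically zero and
`ψ` has compact support in the disk, only finitely many terms are nonzero. -/
def linearStatistic (κ : ℝ) (x : ℕ → ℂ) (ψ : ℂ → ℂ) : ℂ :=
  ∑ᶠ ξ ∈ {ξ : ℂ | ξ ∈ disk κ ∧ powerSeriesFun κ x ξ = 0},
    (analyticOrderNatAt (powerSeriesFun κ x) ξ : ℂ) * ψ ξ

/-- The filter `|u| → ρ_κ`, for `u` in the disk of radius `ρ_κ`. -/
def toBoundary (κ : ℝ) : Filter (disk κ) :=
  comap (fun u : disk κ => ‖(u : ℂ)‖ₑ) (𝓝 (radius κ))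

/-- The standard complex Gaussian distribution (mean zero and `E|Z|² = 1`), with density
`π⁻¹ exp(-|z|²)` with respect to Lebesgue measure on the plane. -/
def stdComplexGaussian : Measure ℂ :=
  (volume : Measure ℂ).withDensity
    (fun z => ENNReal.ofReal (Real.pi⁻¹ * Real.exp (-‖z‖ ^ 2)))

end RandomAnalytic

end

namespace RandomAnalytic

/-! ### The disk and the coefficients -/

section Coefficients

variable {κ : ℝ}

/-! Write f for the series with coefficients X_n. Its covariance E[f(z) conj f(w)] is K(z w̄), where
K(t) = ∑ a_n² t^n = (1 + κt)^(1/κ), read as exp t when κ = 0. Under the automorphisms Φ this kernel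
changes only by a factor g(z) conj g(w) with g zero-free. Hence F(z) = g(z) f(Φ^{-u}(z)), with g =
`weight`, has the covariance of f, and its zeros are the images under Φ^u of the zeros of f
(`linearStatistic_comp_mobius`). Expanding F(z) = ∑ a_k Y_k z^k gives Y_k = ∑_n T_{kn} X_n, where
the matrix T = `transition` depends on u. Invariance of the kernel says that the rows of T are
orthonormal (`hasSum_transition_mul_conj`).

The universality is a central limit theorem for the Y_k. Lindeberg's argument requires that sup_n
|T_{kn}| tend to 0 as |u| → ρ (`eventually_norm_transition_le`). By Cauchy's estimate the entries
are controlled by the transported monomials near 0. The squared modulus of the n-th one at z is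
K(|z|²) times the share of the n-th term in the series K(|Φ^{-u}(z)|²). As Φ^{-u}(z) approaches the
boundary, the largest share tends to 0. So any finite number of the Y_k converge jointly to
independent standard Gaussians (`tendstoInDistribution_marginals`).

To reach the zeros, choose r < ρ such that the support of φ lies in the disk of radius r, and regard
(a_k r^k Y_k) as a random element of ℓ¹. Uniform first moments bound the tails, so the marginals
determine the limit in ℓ¹ (`tendstoInDistribution_ofCoeffs`). The ℓ¹ norm dominates the sup norm on
that disk. By a Hurwitz argument (`tendsto_finsum_analyticOrderNatAt_mul`) the sum over zeros is
therefore continuous away from the zero sequence, which the limit law does not charge, and the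
continuous mapping theorem concludes.

Membership in the disk is used throughout as 0 < 1 + κ|z|², which treats κ = 0 and κ < 0 alike. -/

lemma mem_disk_iff (hκ : κ ≤ 0) {z : ℂ} : z ∈ disk κ ↔ 0 < 1 + κ * ‖z‖ ^ 2 := by
  rcases hκ.eq_or_lt with rfl | h
  · simp [disk, radius, ENNReal.zero_rpow_of_neg]
  · have h1 : 0 < |κ| := abs_pos.mpr h.ne
    have h2 : radius κ = ENNReal.ofReal (|κ| ^ (-(1 / 2) : ℝ)) := by
      rw [radius, ENNReal.ofReal_rpow_of_pos h1]
    have h3 : |κ| ^ (-(1 / 2) : ℝ) = (√|κ|)⁻¹ := by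
      rw [Real.rpow_neg h1.le, Real.sqrt_eq_rpow]
    have h4 : 0 < √|κ| := Real.sqrt_pos.mpr h1
    simp only [disk, Set.mem_ofPred_eq]
    rw [h2, h3, ← ofReal_norm, ENNReal.ofReal_lt_ofReal_iff (by positivity),
      ← one_div, lt_div_iff₀ h4]
    constructor
    · intro h
      have : (‖z‖ * √|κ|) ^ 2 < 1 := by
        rw [sq_lt_one_iff₀ (by positivity)]; exact h
      rw [mul_pow, Real.sq_sqrt h1.le, abs_of_neg ‹κ < 0›] at this
      linarith
    · intro h
      rw [← sq_lt_one_iff₀ (by positivity), mul_pow, Real.sq_sqrt h1.le, abs_of_neg ‹κ < 0›]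
      linarith

lemma coeff_zero : coeff κ 0 = 1 := by simp [coeff]

lemma one_sub_natCast_mul_pos (hκ : κ ≤ 0) (n : ℕ) : 0 < 1 - n * κ := by
  nlinarith [(Nat.cast_nonneg n : (0 : ℝ) ≤ n)]

lemma coeff_succ (n : ℕ) : coeff κ (n + 1) = coeff κ n * √((1 - n * κ) / (n + 1)) := by
  rw [coeff, Finset.prod_Icc_succ_top (by omega), ← coeff]
  push_cast
  ring_nf

lemma coeff_pos (hκ : κ ≤ 0) (n : ℕ) : 0 < coeff κ n := by
  induction n with
  | zero => simp [coeff_zero]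
  | succ n ih =>
    rw [coeff_succ]
    have := one_sub_natCast_mul_pos hκ n
    positivity

lemma coeff_succ_sq (hκ : κ ≤ 0) (n : ℕ) :
    coeff κ (n + 1) ^ 2 = coeff κ n ^ 2 * ((1 - n * κ) / (n + 1)) := by
  have := one_sub_natCast_mul_pos hκ n
  rw [coeff_succ, mul_pow, Real.sq_sqrt (by positivity)]

lemma tendsto_coeff_ratio :
    Tendsto (fun n : ℕ => (1 - n * κ) / ((n : ℝ) + 1)) atTop (𝓝 (-κ)) := by
  have h1 : Tendsto (fun n : ℕ => 1 / ((n : ℝ) + 1)) atTop (𝓝 0) :=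
    tendsto_one_div_add_atTop_nhds_zero_nat
  have h2 : Tendsto (fun n : ℕ => (1 + κ) * (1 / ((n : ℝ) + 1)) - κ) atTop
      (𝓝 ((1 + κ) * 0 - κ)) := (h1.const_mul _).sub_const _
  simp only [mul_zero, zero_sub] at h2
  refine h2.congr fun n => ?_
  have : (n : ℝ) + 1 ≠ 0 := by positivity
  field_simp
  ring

/-- Ratio test: a_{n+1}/a_n tends to √(-κ) = 1/ρ, so the radius of convergence is ρ. -/
lemma summable_coeff_mul_pow (hκ : κ ≤ 0) {s : ℝ} (hs : 0 ≤ s) (hs' : 0 < 1 + κ * s ^ 2) :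
    Summable fun n => coeff κ n * s ^ n := by
  rcases hs.eq_or_lt with rfl | hs0
  · refine summable_of_ne_finset_zero (s := {0}) fun n hn => ?_
    simp at hn
    simp [hn]
  have hl : √(-κ) * s < 1 := by
    rw [← sq_lt_one_iff₀ (by positivity), mul_pow, Real.sq_sqrt (by linarith)]
    linarith
  refine summable_of_ratio_test_tendsto_lt_one hl
    (Eventually.of_forall fun n => (mul_pos (coeff_pos hκ n) (pow_pos hs0 n)).ne') ?_
  refine ((tendsto_coeff_ratio.sqrt).mul_const s).congr fun n => ?_
  have h1 := coeff_pos hκ n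
  have h2 := coeff_pos hκ (n + 1)
  rw [Real.norm_of_nonneg (by positivity), Real.norm_of_nonneg (by positivity), coeff_succ]
  rw [pow_succ]
  field_simp

/-- Provides room for Cauchy estimates and geometric comparison; with s = 0 it supplies a small disk
about the origin. -/
lemma exists_gt_one_add_mul_sq_pos {s : ℝ} (hs' : 0 < 1 + κ * s ^ 2) :
    ∃ r, s < r ∧ 0 < 1 + κ * r ^ 2 := by
  have hc : ContinuousAt (fun r : ℝ => 1 + κ * r ^ 2) s := by fun_prop
  have h : ∀ᶠ r in 𝓝[>] s, 0 < 1 + κ * r ^ 2 :=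
    (hc.eventually_const_lt hs').filter_mono nhdsWithin_le_nhds
  obtain ⟨r, h1, h2⟩ := (h.and self_mem_nhdsWithin).exists
  exact ⟨r, h2, h1⟩

end Coefficients

/-! ### The covariance kernel -/

section Kernel

variable {κ : ℝ}

/-- The logarithm of the covariance kernel of `f_κ`, as a function of `t = z w̄`. -/
noncomputable def logKernel (κ : ℝ) (t : ℂ) : ℂ := if κ = 0 then t else Complex.log (1 + κ * t) / κ

lemma logKernel_zero : logKernel κ 0 = 0 := by simp [logKernel]

lemma one_add_mul_re_pos (hκ : κ ≤ 0) {t : ℂ} (ht : 0 < 1 + κ * ‖t‖) : 0 < (1 + κ * t).re := by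
  have h1 : t.re ≤ ‖t‖ := Complex.re_le_norm t
  have : (1 + κ * t).re = 1 + κ * t.re := by simp
  rw [this]
  nlinarith

lemma one_add_mul_ne_zero (hκ : κ ≤ 0) {t : ℂ} (ht : 0 < 1 + κ * ‖t‖) : (1 + κ * t : ℂ) ≠ 0 := by
  intro h
  have := one_add_mul_re_pos hκ ht
  simp [h] at this

/-- The two branches of `logKernel` share this derivative, so identities proved by differentiation
need no case distinction on κ. -/
lemma hasDerivAt_logKernel (hκ : κ ≤ 0) {t : ℂ} (ht : 0 < 1 + κ * ‖t‖) :
    HasDerivAt (logKernel κ) (1 + κ * t)⁻¹ t := by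
  by_cases h0 : κ = 0
  · subst h0
    have : logKernel 0 = id := by ext t; simp [logKernel]
    rw [this]
    simpa using hasDerivAt_id t
  · have : logKernel κ = fun t => Complex.log (1 + κ * t) / κ := by ext t; simp [logKernel, h0]
    rw [this]
    have h1 : HasDerivAt (fun t : ℂ => 1 + κ * t) κ t := by
      simpa using ((hasDerivAt_id t).const_mul (κ : ℂ)).const_add 1
    have h2 := (h1.clog (Or.inl (one_add_mul_re_pos hκ ht))).div_const (κ : ℂ)
    convert! h2 using 1
    have : (κ : ℂ) ≠ 0 := by exact_mod_cast h0
    rw [div_right_comm, div_self this, one_div]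

lemma logKernel_conj (hκ : κ ≤ 0) {t : ℂ} (ht : 0 < 1 + κ * ‖t‖) :
    logKernel κ (conj t) = conj (logKernel κ t) := by
  by_cases h0 : κ = 0
  · simp [logKernel, h0]
  · have h1 : (1 + κ * conj t : ℂ) = conj (1 + κ * t) := by simp
    have h2 : (1 + κ * t : ℂ).arg ≠ Real.pi := by
      intro h
      rw [Complex.arg_eq_pi_iff] at h
      linarith [one_add_mul_re_pos hκ ht, h.1]
    simp only [logKernel, h0, if_false]
    rw [h1, Complex.log_conj _ h2]
    simp

/-- For κ = 0 this is the exponential series. For κ < 0 it is the binomial series of (1 + κt)^(1/κ),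
because a_n² = choose(1/κ, n) κ^n. -/
lemma hasSum_kernel (hκ : κ ≤ 0) {t : ℂ} (ht : 0 < 1 + κ * ‖t‖) :
    HasSum (fun n => (coeff κ n : ℂ) ^ 2 * t ^ n) (Complex.exp (logKernel κ t)) := by
  by_cases h0 : κ = 0
  · subst h0
    have h1 : ∀ n, (coeff 0 n : ℂ) ^ 2 = (n.factorial : ℂ)⁻¹ := by
      intro n
      have : coeff 0 n ^ 2 = (n.factorial : ℝ)⁻¹ := by
        induction n with
        | zero => simp [coeff_zero]
        | succ n ih =>
          rw [coeff_succ_sq le_rfl, ih, Nat.factorial_succ]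
          push_cast
          have : (n.factorial : ℝ) ≠ 0 := by positivity
          have : (n : ℝ) + 1 ≠ 0 := by positivity
          field_simp
          simp
      rw [← Complex.ofReal_pow, this]
      simp
    have h2 := NormedSpace.expSeries_div_hasSum_exp (𝔸 := ℂ) t
    rw [← Complex.exp_eq_exp_ℂ] at h2
    simp only [logKernel, if_true]
    convert! h2 using 2 with n
    rw [h1, div_eq_mul_inv, mul_comm]
  · have hk : (κ : ℂ) ≠ 0 := by exact_mod_cast h0
    have h1 : ∀ n, (coeff κ n : ℂ) ^ 2 = Ring.choose (1 / κ : ℂ) n * κ ^ n := by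
      intro n
      induction n with
      | zero => simp [coeff_zero]
      | succ n ih =>
        have e1 : (coeff κ (n + 1) : ℂ) ^ 2 =
            (coeff κ n : ℂ) ^ 2 * ((1 - n * κ) / (n + 1)) := by
          exact_mod_cast coeff_succ_sq hκ n
        have e2 : ((n : ℂ) + 1) * Ring.choose (1 / κ : ℂ) (n + 1) =
            Ring.choose (1 / κ : ℂ) n * (1 / κ - n) := by
          have := Ring.choose_smul_choose (1 / κ : ℂ) (Nat.le_succ n)
          simpa [Nat.choose_succ_self_right] using this
        have e3 : (n : ℂ) + 1 ≠ 0 := by exact_mod_cast n.succ_ne_zero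
        rw [e1, ih, ← mul_right_inj' e3]
        rw [show ((n : ℂ) + 1) * (Ring.choose (1 / κ : ℂ) (n + 1) * κ ^ (n + 1)) =
          (((n : ℂ) + 1) * Ring.choose (1 / κ : ℂ) (n + 1)) * κ ^ (n + 1) by ring, e2, pow_succ]
        field_simp
    have h2 := (Complex.one_add_cpow_hasFPowerSeriesOnBall_zero (a := (1 / κ : ℂ))).hasSum
      (y := κ * t) (by
        rw [Metric.mem_eball, edist_zero_right, ← ofReal_norm, ENNReal.ofReal_lt_one, norm_mul,
          Complex.norm_real, Real.norm_of_nonpos hκ]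
        linarith)
    simp only [zero_add, binomialSeries_apply] at h2
    rw [Complex.cpow_def_of_ne_zero (one_add_mul_ne_zero hκ ht)] at h2
    simp only [logKernel, h0, if_false]
    rw [div_eq_mul_one_div]
    convert! h2 using 2 with n
    rw [h1]
    simp [mul_pow]
    ring

end Kernel

/-! ### The Möbius transformations and the invariance of the kernel -/

section Mobius

variable {κ : ℝ}

lemma one_add_mul_norm_mul_pos (hκ : κ ≤ 0) {z w : ℂ} (hz : 0 < 1 + κ * ‖z‖ ^ 2)
    (hw : 0 < 1 + κ * ‖w‖ ^ 2) : 0 < 1 + κ * ‖z * w‖ := by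
  rw [norm_mul]
  nlinarith [sq_nonneg (‖z‖ - ‖w‖), mul_nonneg (neg_nonneg.mpr hκ) (sq_nonneg (‖z‖ - ‖w‖))]

lemma mobius_denom_ne_zero (hκ : κ ≤ 0) {v z : ℂ} (hv : 0 < 1 + κ * ‖v‖ ^ 2)
    (hz : 0 < 1 + κ * ‖z‖ ^ 2) : 1 + κ * conj v * z ≠ 0 := by
  rw [mul_assoc]
  exact one_add_mul_ne_zero hκ (one_add_mul_norm_mul_pos hκ (by simpa using hv) hz)

lemma mobius_mul_denom (hκ : κ ≤ 0) {v z : ℂ} (hv : 0 < 1 + κ * ‖v‖ ^ 2)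
    (hz : 0 < 1 + κ * ‖z‖ ^ 2) : mobius κ v z * (1 + κ * conj v * z) = z - v :=
  div_mul_cancel₀ _ (mobius_denom_ne_zero hκ hv hz)

lemma conj_mobius_mul_denom (hκ : κ ≤ 0) {v z : ℂ} (hv : 0 < 1 + κ * ‖v‖ ^ 2)
    (hz : 0 < 1 + κ * ‖z‖ ^ 2) :
    conj (mobius κ v z) * (1 + κ * v * conj z) = conj z - conj v := by
  simpa using congrArg conj (mobius_mul_denom hκ hv hz)

/-- The algebraic source of the invariance: the kernel is the 1/κ-th power of this expression, and
on the right only the factor 1 + κ z w̄ mixes z and w. -/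
lemma one_add_mul_mobius_mul_conj (hκ : κ ≤ 0) {v z w : ℂ} (hv : 0 < 1 + κ * ‖v‖ ^ 2)
    (hz : 0 < 1 + κ * ‖z‖ ^ 2) (hw : 0 < 1 + κ * ‖w‖ ^ 2) :
    1 + κ * (mobius κ v z * conj (mobius κ v w)) =
      (1 + κ * (v * conj v)) * (1 + κ * (z * conj w)) /
        ((1 + κ * conj v * z) * (1 + κ * v * conj w)) := by
  have h1 := mobius_denom_ne_zero hκ hv hz
  have h2 : 1 + κ * v * conj w ≠ 0 := by
    simpa using (map_ne_zero (starRingEnd ℂ)).mpr (mobius_denom_ne_zero hκ hv hw)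
  have h3 := mobius_mul_denom hκ hv hz
  have h4 := conj_mobius_mul_denom hκ hv hw
  rw [eq_div_iff (mul_ne_zero h1 h2)]
  linear_combination κ * conj (mobius κ v w) * (1 + κ * v * conj w) * h3 + κ * (z - v) * h4

lemma one_add_mul_norm_mobius_sq (hκ : κ ≤ 0) {v z : ℂ} (hv : 0 < 1 + κ * ‖v‖ ^ 2)
    (hz : 0 < 1 + κ * ‖z‖ ^ 2) :
    1 + κ * ‖mobius κ v z‖ ^ 2 =
      (1 + κ * ‖v‖ ^ 2) * (1 + κ * ‖z‖ ^ 2) / ‖1 + κ * conj v * z‖ ^ 2 := by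
  have h := one_add_mul_mobius_mul_conj hκ hv hz hz
  rw [show 1 + κ * v * conj z = conj (1 + κ * conj v * z) by simp] at h
  simp only [Complex.mul_conj, Complex.normSq_eq_norm_sq] at h
  exact_mod_cast h

lemma mobius_mem (hκ : κ ≤ 0) {v z : ℂ} (hv : 0 < 1 + κ * ‖v‖ ^ 2)
    (hz : 0 < 1 + κ * ‖z‖ ^ 2) : 0 < 1 + κ * ‖mobius κ v z‖ ^ 2 := by
  rw [one_add_mul_norm_mobius_sq hκ hv hz]
  have := norm_pos_iff.mpr (mobius_denom_ne_zero hκ hv hz)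
  positivity

lemma one_add_mul_conj_mul_self_ne_zero {v : ℂ} (hv : 0 < 1 + κ * ‖v‖ ^ 2) :
    (1 + κ * conj v * v : ℂ) ≠ 0 := by
  rw [mul_assoc, Complex.conj_mul']
  exact_mod_cast hv.ne'

lemma mobius_neg_mobius (hκ : κ ≤ 0) {v z : ℂ} (hv : 0 < 1 + κ * ‖v‖ ^ 2)
    (hz : 0 < 1 + κ * ‖z‖ ^ 2) : mobius κ (-v) (mobius κ v z) = z := by
  have h3 := mobius_denom_ne_zero hκ (v := -v) (by simpa using hv) (mobius_mem hκ hv hz)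
  rw [mobius, div_eq_iff h3, map_neg]
  linear_combination mobius_mul_denom hκ hv hz

lemma hasDerivAt_mobius (hκ : κ ≤ 0) {v z : ℂ} (hv : 0 < 1 + κ * ‖v‖ ^ 2)
    (hz : 0 < 1 + κ * ‖z‖ ^ 2) :
    HasDerivAt (mobius κ v) ((1 + κ * conj v * v) / (1 + κ * conj v * z) ^ 2) z := by
  have h1 := mobius_denom_ne_zero hκ hv hz
  have h2 : HasDerivAt (fun z : ℂ => z - v) 1 z := (hasDerivAt_id z).sub_const v
  have h3 : HasDerivAt (fun z : ℂ => 1 + κ * conj v * z) (κ * conj v) z := by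
    simpa using ((hasDerivAt_id z).const_mul (κ * conj v : ℂ)).const_add 1
  convert! h2.div h3 h1 using 1
  congr 1
  ring

lemma one_add_mul_sq_pos_of_le (hκ : κ ≤ 0) {a b : ℝ} (ha : 0 ≤ a) (hab : a ≤ b)
    (hb : 0 < 1 + κ * b ^ 2) : 0 < 1 + κ * a ^ 2 := by
  have : a ^ 2 ≤ b ^ 2 := by gcongr
  nlinarith

/-- Taking logarithms in `one_add_mul_mobius_mul_conj` would require tracking branches. Instead the
left side is shown to have zero derivative in z on a ball about 0, and the right side is its value
at z = 0. -/
lemma logKernel_mobius_aux (hκ : κ ≤ 0) {v z w : ℂ} (hv : 0 < 1 + κ * ‖v‖ ^ 2)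
    (hz : 0 < 1 + κ * ‖z‖ ^ 2) (hw : 0 < 1 + κ * ‖w‖ ^ 2) :
    logKernel κ (mobius κ v z * conj (mobius κ v w)) + logKernel κ (conj v * z) -
      logKernel κ (z * conj w) = logKernel κ (-v * conj (mobius κ v w)) := by
  obtain ⟨R, hzR, hR⟩ := exists_gt_one_add_mul_sq_pos hz
  have hmem : ∀ x ∈ Metric.ball (0 : ℂ) R, 0 < 1 + κ * ‖x‖ ^ 2 := fun x hx =>
    one_add_mul_sq_pos_of_le hκ (norm_nonneg x) (by simpa using (mem_ball_zero_iff.mp hx).le) hR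
  have hd : ∀ x ∈ Metric.ball (0 : ℂ) R, HasDerivAt (fun x =>
      logKernel κ (mobius κ v x * conj (mobius κ v w)) + logKernel κ (conj v * x) -
      logKernel κ (x * conj w)) 0 x := by
    intro x hx
    have hx := hmem x hx
    have a1 := mobius_denom_ne_zero hκ hv hx
    have a2 : 1 + κ * v * conj w ≠ 0 := by
      simpa using (map_ne_zero (starRingEnd ℂ)).mpr (mobius_denom_ne_zero hκ hv hw)
    have m1 := one_add_mul_norm_mul_pos hκ (mobius_mem hκ hv hx)
      (w := conj (mobius κ v w)) (by simpa using mobius_mem hκ hv hw)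
    have m2 := one_add_mul_norm_mul_pos hκ (z := conj v) (by simpa using hv) hx
    have m3 := one_add_mul_norm_mul_pos hκ hx (w := conj w) (by simpa using hw)
    have d1 := (hasDerivAt_logKernel hκ m1).comp x
      ((hasDerivAt_mobius hκ hv hx).mul_const (conj (mobius κ v w)))
    have d2 := (hasDerivAt_logKernel hκ m2).comp x ((hasDerivAt_id x).const_mul (conj v))
    have d3 := (hasDerivAt_logKernel hκ m3).comp x ((hasDerivAt_id x).mul_const (conj w))
    convert! (d1.add d2).sub d3 using 1
    have b1 := one_add_mul_ne_zero hκ m1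
    have b3 := one_add_mul_ne_zero hκ m3
    have b4 := one_add_mul_conj_mul_self_ne_zero hv
    -- With B = 1 + κ v̄ x and D = 1 + κ x w̄, this turns the derivative into (w̄ - v̄)/(BD) + v̄/B
    -- - w̄/D, which vanishes identically.
    have e1 : (1 + κ * (mobius κ v x * conj (mobius κ v w)))⁻¹ *
        ((1 + κ * conj v * v) / (1 + κ * conj v * x) ^ 2 * conj (mobius κ v w)) =
        (conj w - conj v) / ((1 + κ * conj v * x) * (1 + κ * (x * conj w))) := by
      rw [← conj_mobius_mul_denom hκ hv hw, one_add_mul_mobius_mul_conj hκ hv hx hw, inv_div,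
        mul_comm v (conj v), ← mul_assoc (κ : ℂ) (conj v) v]
      generalize 1 + κ * conj v * v = A at *
      generalize 1 + κ * conj v * x = B at *
      generalize 1 + κ * (x * conj w) = D at *
      field_simp
    rw [e1, ← mul_assoc (κ : ℂ) (conj v) x, mul_one, one_mul, ← one_div, ← one_div,
      div_mul_eq_mul_div, div_mul_eq_mul_div, div_add_div _ _ (mul_ne_zero a1 b3) a1,
      div_sub_div _ _ (mul_ne_zero (mul_ne_zero a1 b3) a1) b3]
    symm
    rw [div_eq_zero_iff]
    left
    ring
  have h0 : (0 : ℂ) ∈ Metric.ball (0 : ℂ) R := by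
    simpa using (norm_nonneg z).trans_lt hzR
  have := Metric.isOpen_ball.is_const_of_deriv_eq_zero
    (convex_ball (0 : ℂ) R).isPreconnected
    (fun x hx => (hd x hx).differentiableAt.differentiableWithinAt)
    (fun x hx => (hd x hx).deriv) (show z ∈ Metric.ball (0 : ℂ) R by simpa using hzR) h0
  simpa [logKernel_zero, mobius] using this

/-- The right side of `logKernel_mobius_aux` is evaluated by the same lemma at the pair (w, 0),
followed by complex conjugation. -/
lemma logKernel_mobius (hκ : κ ≤ 0) {v z w : ℂ} (hv : 0 < 1 + κ * ‖v‖ ^ 2)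
    (hz : 0 < 1 + κ * ‖z‖ ^ 2) (hw : 0 < 1 + κ * ‖w‖ ^ 2) :
    logKernel κ (mobius κ v z * conj (mobius κ v w)) + logKernel κ (conj v * z) +
      logKernel κ (v * conj w) = logKernel κ (z * conj w) + logKernel κ (v * conj v) := by
  have h1 := logKernel_mobius_aux hκ hv hz hw
  have h2 := logKernel_mobius_aux hκ hv hw (w := 0) (by simp)
  have h3 : mobius κ v 0 = -v := by simp [mobius]
  rw [h3] at h2
  simp only [map_zero, mul_zero, logKernel_zero, sub_zero, map_neg, neg_mul_neg] at h2
  have c1 := logKernel_conj hκ (one_add_mul_norm_mul_pos hκ (mobius_mem hκ hv hw)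
    (w := - conj v) (by simpa using hv))
  have c2 := logKernel_conj hκ (one_add_mul_norm_mul_pos hκ (z := conj v) (by simpa using hv) hw)
  have c3 := logKernel_conj hκ (one_add_mul_norm_mul_pos hκ hv
    (w := conj v) (by simpa using hv))
  have h4 := congrArg conj h2
  rw [map_add, ← c1, ← c2, ← c3] at h4
  simp only [map_mul, map_neg, Complex.conj_conj, mul_comm (conj (mobius κ v w)),
    mul_neg, neg_mul, mul_comm (conj v) v] at h4 h1 ⊢
  linear_combination h1 + h4

end Mobius

/-! ### The transition coefficients -/

section PowerSeries

/-- The coefficients of a convergent complex power series are determined by its sum. -/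
lemma eq_of_hasSum_mul_pow {c d : ℕ → ℂ} {f : ℂ → ℂ} {r : ℝ} (hr : 0 < r)
    (hc : ∀ z, ‖z‖ < r → HasSum (fun n => c n * z ^ n) (f z))
    (hd : ∀ z, ‖z‖ < r → HasSum (fun n => d n * z ^ n) (f z)) : c = d := by
  have key : ∀ e : ℕ → ℂ, (∀ z, ‖z‖ < r → HasSum (fun n => e n * z ^ n) (f z)) →
      HasFPowerSeriesAt f (FormalMultilinearSeries.ofScalars ℂ e) 0 := by
    intro e he
    rw [hasFPowerSeriesAt_iff]
    filter_upwards [Metric.ball_mem_nhds (0 : ℂ) hr] with z hz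
    simpa [mul_comm, FormalMultilinearSeries.coeff_ofScalars] using he z (by simpa using hz)
  have h := (key c hc).eq_formalMultilinearSeries (key d hd)
  ext n
  simpa [FormalMultilinearSeries.coeff_ofScalars] using congrArg (fun p => p.coeff n) h

/-- Interchange of a double series dominated by a product. -/
lemma hasSum_tsum_of_norm_le_mul {f : ℕ → ℕ → ℂ} {s : ℕ → ℂ} {A B : ℕ → ℝ}
    (hA : Summable A) (hB : Summable B) (hA0 : ∀ n, 0 ≤ A n) (hB0 : ∀ n, 0 ≤ B n)
    (hf : ∀ k n, ‖f k n‖ ≤ A n * B k) (hs : ∀ n, HasSum (fun k => f k n) (s n)) :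
    HasSum (fun k => ∑' n, f k n) (∑' n, s n) := by
  have h1 : Summable (fun p : ℕ × ℕ => f p.2 p.1) :=
    Summable.of_norm_bounded (hA.mul_of_nonneg hB hA0 hB0) fun p => hf p.2 p.1
  have h2 : Summable (fun p : ℕ × ℕ => f p.1 p.2) := h1.prod_symm
  have h3 : ∑' n, s n = ∑' k, ∑' n, f k n := by
    rw [← h2.tsum_comm]
    exact tsum_congr fun n => (hs n).tsum_eq.symm
  rw [h3]
  exact h2.prod.hasSum

end PowerSeries

section Transition

variable {κ : ℝ}

/-- The nonvanishing factor that turns `f_κ ∘ Φ` into a function with the covariance of `f_κ`. -/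
noncomputable def weight (κ : ℝ) (v z : ℂ) : ℂ :=
  Complex.exp (logKernel κ (conj v * z) - logKernel κ (v * conj v) / 2)

lemma weight_ne_zero (v z : ℂ) : weight κ v z ≠ 0 := Complex.exp_ne_zero _

/-- The monomials `a_n z^n`, transported by a Möbius transformation. -/
noncomputable def transported (κ : ℝ) (v : ℂ) (n : ℕ) (z : ℂ) : ℂ :=
  coeff κ n * mobius κ v z ^ n * weight κ v z

/-- The coefficients of the transported monomials with respect to the monomials `a_k z^k`. -/
noncomputable def transition (κ : ℝ) (v : ℂ) (k n : ℕ) : ℂ :=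
  (coeff κ k : ℂ)⁻¹ * ((k.factorial : ℂ)⁻¹ * iteratedDeriv k (transported κ v n) 0)

/-- The sequences whose power series `∑ a_n x_n z^n` converges absolutely on the disk. -/
def Admissible (κ : ℝ) (x : ℕ → ℂ) : Prop :=
  ∀ s : ℝ, 0 ≤ s → 0 < 1 + κ * s ^ 2 → Summable fun n => ‖x n‖ * (coeff κ n * s ^ n)

lemma admissible_of_bounded (hκ : κ ≤ 0) {x : ℕ → ℂ} {C : ℝ} (hx : ∀ n, ‖x n‖ ≤ C) :
    Admissible κ x := by
  intro s hs hs'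
  refine Summable.of_nonneg_of_le (fun n => ?_) (fun n => ?_)
    ((summable_coeff_mul_pow hκ hs hs').mul_left C)
  · have := coeff_pos hκ n
    positivity
  · have := coeff_pos hκ n
    gcongr
    exact hx n

lemma differentiableAt_weight (hκ : κ ≤ 0) {v z : ℂ} (hv : 0 < 1 + κ * ‖v‖ ^ 2)
    (hz : 0 < 1 + κ * ‖z‖ ^ 2) : DifferentiableAt ℂ (weight κ v) z := by
  have m := one_add_mul_norm_mul_pos hκ (z := conj v) (by simpa using hv) hz
  have h := ((hasDerivAt_logKernel hκ m).differentiableAt.comp z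
    ((differentiableAt_id (x := z)).const_mul (conj v)))
  exact (h.sub_const _).cexp

lemma differentiableAt_transported (hκ : κ ≤ 0) {v z : ℂ} (hv : 0 < 1 + κ * ‖v‖ ^ 2)
    (hz : 0 < 1 + κ * ‖z‖ ^ 2) (n : ℕ) : DifferentiableAt ℂ (transported κ v n) z :=
  (((hasDerivAt_mobius hκ hv hz).differentiableAt.pow n).const_mul _).mul
    (differentiableAt_weight hκ hv hz)

/-- Invariance of the covariance: the transported monomials reproduce the same kernel as the
monomials a_n z^n. The two weights supply exactly the factors left over in `logKernel_mobius`. -/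
lemma hasSum_transported_mul_conj (hκ : κ ≤ 0) {v z w : ℂ} (hv : 0 < 1 + κ * ‖v‖ ^ 2)
    (hz : 0 < 1 + κ * ‖z‖ ^ 2) (hw : 0 < 1 + κ * ‖w‖ ^ 2) :
    HasSum (fun n => transported κ v n z * conj (transported κ v n w))
      (Complex.exp (logKernel κ (z * conj w))) := by
  have h1 := hasSum_kernel hκ (one_add_mul_norm_mul_pos hκ (mobius_mem hκ hv hz)
      (w := conj (mobius κ v w)) (by simpa using mobius_mem hκ hv hw))
  have h2 := h1.mul_right (weight κ v z * conj (weight κ v w))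
  convert! h2 using 1
  · ext n
    simp only [transported, map_mul, map_pow, Complex.conj_ofReal]
    ring
  · have c1 := logKernel_conj hκ
      (one_add_mul_norm_mul_pos hκ (z := conj v) (by simpa using hv) hw)
    have c2 := logKernel_conj hκ
      (one_add_mul_norm_mul_pos hκ hv (w := conj v) (by simpa using hv))
    have c3 : conj (weight κ v w) =
        Complex.exp (logKernel κ (v * conj w) - logKernel κ (v * conj v) / 2) := by
      rw [weight, ← Complex.exp_conj, map_sub, map_div₀, ← c1, ← c2]
      simp [mul_comm, Complex.conj_ofNat]
    rw [c3, weight, ← Complex.exp_add, ← Complex.exp_add]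
    congr 1
    linear_combination -logKernel_mobius hκ hv hz hw

lemma ball_subset_of_pos (hκ : κ ≤ 0) {r : ℝ} (hr : 0 < 1 + κ * r ^ 2) {z : ℂ} (hz : ‖z‖ ≤ r) :
    0 < 1 + κ * ‖z‖ ^ 2 :=
  one_add_mul_sq_pos_of_le hκ (norm_nonneg z) hz hr

lemma hasSum_transition (hκ : κ ≤ 0) {v z : ℂ} (hv : 0 < 1 + κ * ‖v‖ ^ 2)
    (hz : 0 < 1 + κ * ‖z‖ ^ 2) (n : ℕ) :
    HasSum (fun k => coeff κ k * transition κ v k n * z ^ k) (transported κ v n z) := by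
  obtain ⟨R, hzR, hR⟩ := exists_gt_one_add_mul_sq_pos hz
  have hd : DifferentiableOn ℂ (transported κ v n) (Metric.ball 0 R) := fun x hx =>
    (differentiableAt_transported hκ hv (ball_subset_of_pos hκ hR
      (mem_ball_zero_iff.mp hx).le) n).differentiableWithinAt
  have h := Complex.hasSum_taylorSeries_on_ball hd (z := z) (by simpa using hzR)
  refine h.congr_fun fun k => ?_
  have := coeff_pos hκ k
  have h0 : (coeff κ k : ℂ) ≠ 0 := by exact_mod_cast this.ne'
  simp only [transition, sub_zero, smul_eq_mul]
  rw [mul_inv_cancel_left₀ h0]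
  ring

/-- Cauchy's estimate for the k-th Taylor coefficient on the circle of radius r. -/
lemma norm_transition_le (hκ : κ ≤ 0) {v : ℂ} (hv : 0 < 1 + κ * ‖v‖ ^ 2) {r M : ℝ} (hr : 0 < r)
    (hr' : 0 < 1 + κ * r ^ 2) (n : ℕ) (hM : ∀ z, ‖z‖ ≤ r → ‖transported κ v n z‖ ≤ M) (k : ℕ) :
    coeff κ k * ‖transition κ v k n‖ * r ^ k ≤ M := by
  have hd : DifferentiableOn ℂ (transported κ v n) (Metric.closedBall 0 r) := fun x hx =>
    (differentiableAt_transported hκ hv (ball_subset_of_pos hκ hr'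
      (mem_closedBall_zero_iff.mp hx)) n).differentiableWithinAt
  have h := Complex.norm_iteratedDeriv_le_of_forall_mem_sphere_norm_le k hr
    (hd.diffContOnCl_ball subset_rfl) (C := M)
    (fun z hz => hM z (mem_sphere_zero_iff_norm.mp hz).le)
  have h1 := coeff_pos hκ k
  rw [le_div_iff₀ (by positivity)] at h
  have h2 : coeff κ k * ‖transition κ v k n‖ =
      (k.factorial : ℝ)⁻¹ * ‖iteratedDeriv k (transported κ v n) 0‖ := by
    rw [transition, norm_mul, norm_mul, norm_inv, norm_inv, Complex.norm_real,
      Real.norm_of_nonneg h1.le, Complex.norm_natCast, ← mul_assoc, mul_inv_cancel₀ h1.ne', one_mul]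
  rw [h2, mul_assoc, inv_mul_le_iff₀ (by positivity)]
  exact h

/-- The Möbius map sends the closed disk of radius r to a compact subset of the open disk. So s, the
largest modulus attained, is still admissible, and the bound is summable against any admissible
sequence. -/
lemma exists_norm_transported_le (hκ : κ ≤ 0) {v : ℂ} (hv : 0 < 1 + κ * ‖v‖ ^ 2) {r : ℝ}
    (hr : 0 ≤ r) (hr' : 0 < 1 + κ * r ^ 2) : ∃ C s : ℝ, 0 ≤ C ∧ 0 ≤ s ∧ 0 < 1 + κ * s ^ 2 ∧
      ∀ n z, ‖z‖ ≤ r → ‖transported κ v n z‖ ≤ C * (coeff κ n * s ^ n) := by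
  have hc : IsCompact (Metric.closedBall (0 : ℂ) r) := isCompact_closedBall 0 r
  have hne : (Metric.closedBall (0 : ℂ) r).Nonempty := ⟨0, by simpa using hr⟩
  have hmem : ∀ x ∈ Metric.closedBall (0 : ℂ) r, 0 < 1 + κ * ‖x‖ ^ 2 := fun x hx =>
    ball_subset_of_pos hκ hr' (mem_closedBall_zero_iff.mp hx)
  obtain ⟨x, hx, hxm⟩ := hc.exists_isMaxOn hne (f := fun z => ‖mobius κ v z‖)
    (fun z hz => (hasDerivAt_mobius hκ hv (hmem z hz)).continuousAt.norm.continuousWithinAt)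
  obtain ⟨y, hy, hym⟩ := hc.exists_isMaxOn hne (f := fun z => ‖weight κ v z‖)
    (fun z hz => (differentiableAt_weight hκ hv
      (hmem z hz)).continuousAt.norm.continuousWithinAt)
  refine ⟨‖weight κ v y‖, ‖mobius κ v x‖, norm_nonneg _, norm_nonneg _,
    mobius_mem hκ hv (hmem x hx), fun n z hz => ?_⟩
  have hz' : z ∈ Metric.closedBall (0 : ℂ) r := by simpa using hz
  have h1 : ‖mobius κ v z‖ ≤ ‖mobius κ v x‖ := hxm hz'
  have h2 : ‖weight κ v z‖ ≤ ‖weight κ v y‖ := hym hz'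
  have h3 := coeff_pos hκ n
  rw [transported, norm_mul, norm_mul, norm_pow, Complex.norm_real, Real.norm_of_nonneg h3.le,
    mul_comm]
  gcongr

/-- The sequence of coefficients of a transported power series. -/
noncomputable def transport (κ : ℝ) (v : ℂ) (x : ℕ → ℂ) (k : ℕ) : ℂ :=
  ∑' n, transition κ v k n * x n

/-- The majorant A does not depend on k. Evaluating at |z| < r leaves a factor (|z|/r)^k, so the
double series over k and n is dominated by a product and may be interchanged. -/
lemma exists_norm_transition_mul_le (hκ : κ ≤ 0) {v : ℂ} (hv : 0 < 1 + κ * ‖v‖ ^ 2)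
    {x : ℕ → ℂ} (hx : Admissible κ x) {r : ℝ} (hr : 0 < r) (hr' : 0 < 1 + κ * r ^ 2) :
    ∃ A : ℕ → ℝ, Summable A ∧ (∀ n, 0 ≤ A n) ∧
      ∀ k n, coeff κ k * ‖transition κ v k n * x n‖ * r ^ k ≤ A n := by
  obtain ⟨C, s, hC, hs, hs', h⟩ := exists_norm_transported_le hκ hv hr.le hr'
  refine ⟨fun n => C * (‖x n‖ * (coeff κ n * s ^ n)), (hx s hs hs').mul_left C, fun n => ?_,
    fun k n => ?_⟩
  · have := coeff_pos hκ n
    positivity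
  · have := norm_transition_le hκ hv hr hr' n (h n) k
    rw [norm_mul]
    calc coeff κ k * (‖transition κ v k n‖ * ‖x n‖) * r ^ k
        = (coeff κ k * ‖transition κ v k n‖ * r ^ k) * ‖x n‖ := by ring
      _ ≤ C * (coeff κ n * s ^ n) * ‖x n‖ := by gcongr
      _ = _ := by ring

lemma summable_transition_mul (hκ : κ ≤ 0) {v : ℂ} (hv : 0 < 1 + κ * ‖v‖ ^ 2)
    {x : ℕ → ℂ} (hx : Admissible κ x) (k : ℕ) : Summable fun n => transition κ v k n * x n := by
  obtain ⟨r, hr, hr'⟩ := exists_gt_one_add_mul_sq_pos (κ := κ) (s := 0) (by simp)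
  obtain ⟨A, hA, -, h⟩ := exists_norm_transition_mul_le hκ hv hx hr hr'
  have h1 : 0 < coeff κ k * r ^ k := mul_pos (coeff_pos hκ k) (pow_pos hr k)
  refine Summable.of_norm_bounded (hA.mul_left (coeff κ k * r ^ k)⁻¹) fun n => ?_
  rw [inv_mul_eq_div, le_div_iff₀ h1]
  linarith [h k n]

lemma exists_norm_transport_le (hκ : κ ≤ 0) {v : ℂ} (hv : 0 < 1 + κ * ‖v‖ ^ 2)
    {x : ℕ → ℂ} (hx : Admissible κ x) {r : ℝ} (hr : 0 < r) (hr' : 0 < 1 + κ * r ^ 2) :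
    ∃ C, ∀ k, coeff κ k * ‖transport κ v x k‖ * r ^ k ≤ C := by
  obtain ⟨A, hA, -, h⟩ := exists_norm_transition_mul_le hκ hv hx hr hr'
  refine ⟨∑' n, A n, fun k => ?_⟩
  have h1 : 0 < coeff κ k * r ^ k := mul_pos (coeff_pos hκ k) (pow_pos hr k)
  have h2 := (summable_transition_mul hκ hv hx k).norm
  calc coeff κ k * ‖transport κ v x k‖ * r ^ k
      = coeff κ k * r ^ k * ‖transport κ v x k‖ := by ring
    _ ≤ coeff κ k * r ^ k * ∑' n, ‖transition κ v k n * x n‖ := by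
        gcongr; exact norm_tsum_le_tsum_norm h2
    _ = ∑' n, coeff κ k * r ^ k * ‖transition κ v k n * x n‖ := tsum_mul_left.symm
    _ ≤ ∑' n, A n := (h2.mul_left _).tsum_le_tsum (fun n => by linarith [h k n]) hA

lemma admissible_transport (hκ : κ ≤ 0) {v : ℂ} (hv : 0 < 1 + κ * ‖v‖ ^ 2)
    {x : ℕ → ℂ} (hx : Admissible κ x) : Admissible κ (transport κ v x) := by
  intro s hs hs'
  obtain ⟨r, hr, hr'⟩ := exists_gt_one_add_mul_sq_pos hs'
  have hr0 := hs.trans_lt hr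
  obtain ⟨C, hC⟩ := exists_norm_transport_le hκ hv hx hr0 hr'
  have hq : Summable fun k : ℕ => (s / r) ^ k :=
    summable_geometric_of_lt_one (by positivity) ((div_lt_one hr0).mpr hr)
  refine Summable.of_nonneg_of_le (fun k => ?_) (fun k => ?_) (hq.mul_left C)
  · have := coeff_pos hκ k
    positivity
  · have : ‖transport κ v x k‖ * (coeff κ k * s ^ k) =
      (coeff κ k * ‖transport κ v x k‖ * r ^ k) * (s / r) ^ k := by
      rw [div_pow]; field_simp
    rw [this]
    gcongr
    exact hC k

lemma hasSum_transport (hκ : κ ≤ 0) {v z : ℂ} (hv : 0 < 1 + κ * ‖v‖ ^ 2)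
    {x : ℕ → ℂ} (hx : Admissible κ x) (hz : 0 < 1 + κ * ‖z‖ ^ 2) :
    HasSum (fun k => coeff κ k * transport κ v x k * z ^ k) (∑' n, x n * transported κ v n z) := by
  obtain ⟨r, hr, hr'⟩ := exists_gt_one_add_mul_sq_pos hz
  have hr0 := (norm_nonneg z).trans_lt hr
  obtain ⟨A, hA, hA0, h⟩ := exists_norm_transition_mul_le hκ hv hx hr0 hr'
  have hq : Summable fun k : ℕ => (‖z‖ / r) ^ k :=
    summable_geometric_of_lt_one (by positivity) ((div_lt_one hr0).mpr hr)
  have := hasSum_tsum_of_norm_le_mul (f := fun k n => x n *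
    (coeff κ k * transition κ v k n * z ^ k))
    (s := fun n => x n * transported κ v n z) hA hq hA0 (fun k => by positivity) (fun k n => ?_)
    (fun n => (hasSum_transition hκ hv hz n).mul_left _)
  · convert! this using 2 with k
    rw [transport, ← tsum_mul_left, ← tsum_mul_right]
    exact tsum_congr fun n => by ring
  · have h0 := coeff_pos hκ k
    have : ‖x n * (coeff κ k * transition κ v k n * z ^ k)‖ =
        (coeff κ k * ‖transition κ v k n * x n‖ * r ^ k) * (‖z‖ / r) ^ k := by
      rw [norm_mul, norm_mul, norm_mul, norm_mul, norm_pow, Complex.norm_real,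
        Real.norm_of_nonneg h0.le, div_pow]
      field_simp
    rw [this]
    gcongr
    exact h k n

/-- The rows of the transition matrix are orthonormal. -/
lemma hasSum_transition_mul_conj (hκ : κ ≤ 0) {v : ℂ} (hv : 0 < 1 + κ * ‖v‖ ^ 2) (j k : ℕ) :
    HasSum (fun n => transition κ v j n * conj (transition κ v k n)) (if j = k then 1 else 0) := by
  obtain ⟨r, hr, hr'⟩ := exists_gt_one_add_mul_sq_pos (κ := κ) (s := 0) (by simp)
  have hc : ∀ k, (coeff κ k : ℂ) ≠ 0 := fun k => by exact_mod_cast (coeff_pos hκ k).ne'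
  have hD : ∀ z : ℂ, ‖z‖ < r → 0 < 1 + κ * ‖z‖ ^ 2 := fun z hz => ball_subset_of_pos hκ hr' hz.le
  have adm : ∀ w : ℂ, ‖w‖ < r → Admissible κ fun n => conj (transported κ v n w) := by
    intro w hw
    obtain ⟨C, s, hC, hs, hs', h⟩ := exists_norm_transported_le hκ hv (norm_nonneg w) (hD w hw)
    obtain ⟨B, hB⟩ := (summable_coeff_mul_pow hκ hs hs').tendsto_atTop_zero.bddAbove_range
    refine admissible_of_bounded hκ (C := C * B) fun n => ?_
    rw [RCLike.norm_conj]
    exact (h n w le_rfl).trans (by gcongr; exact hB ⟨n, rfl⟩)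
  -- Both sides are the Taylor coefficients in z of K(z w̄), up to the factor a_k: one from the
  -- transported monomials, the other from the kernel series itself.
  have s1 : ∀ w : ℂ, ‖w‖ < r → ∀ k,
      transport κ v (fun n => conj (transported κ v n w)) k = coeff κ k * conj w ^ k := by
    intro w hw k
    have e := eq_of_hasSum_mul_pow (f := fun z => Complex.exp (logKernel κ (z * conj w)))
      (c := fun k => coeff κ k * transport κ v (fun n => conj (transported κ v n w)) k)
      (d := fun k => coeff κ k ^ 2 * conj w ^ k) hr (fun z hz => ?_) (fun z hz => ?_)
    · have := congrFun e k
      refine mul_left_cancel₀ (hc k) (this.trans ?_)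
      ring
    · have := hasSum_transport hκ hv (adm w hw) (hD z hz)
      rw [← (hasSum_transported_mul_conj hκ hv (hD z hz) (hD w hw)).tsum_eq]
      simpa only [mul_comm (transported κ v _ z)] using this
    · have := hasSum_kernel hκ (one_add_mul_norm_mul_pos hκ (hD z hz)
        (w := conj w) (by simpa using hD w hw))
      refine this.congr_fun fun k => ?_
      rw [mul_pow]; ring
  have adm' : Admissible κ fun n => conj (transition κ v k n) := by
    obtain ⟨C, s, hC, hs, hs', h⟩ := exists_norm_transported_le hκ hv hr.le hr'
    obtain ⟨B, hB⟩ := (summable_coeff_mul_pow hκ hs hs').tendsto_atTop_zero.bddAbove_range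
    have h0 : 0 < coeff κ k * r ^ k := mul_pos (coeff_pos hκ k) (pow_pos hr k)
    refine admissible_of_bounded hκ (C := C * B / (coeff κ k * r ^ k)) fun n => ?_
    rw [RCLike.norm_conj, le_div_iff₀ h0]
    have h1 := norm_transition_le hκ hv hr hr' n (h n) k
    have h2 : C * (coeff κ n * s ^ n) ≤ C * B := by gcongr; exact hB ⟨n, rfl⟩
    linarith
  -- The conjugate of `s1` says that the sequence conj T_{kn} is transported to the single monomial
  -- a_k z^k. Comparing coefficients a second time yields orthonormality.
  have e := eq_of_hasSum_mul_pow (f := fun z => coeff κ k * z ^ k)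
    (c := fun j => coeff κ j * transport κ v (fun n => conj (transition κ v k n)) j)
    (d := fun j => if j = k then (coeff κ k : ℂ) else 0) hr (fun z hz => ?_) (fun z hz => ?_)
  · have e1 : transport κ v (fun n => conj (transition κ v k n)) j = if j = k then 1 else 0 := by
      have := congrFun e j
      refine mul_left_cancel₀ (hc j) (this.trans ?_)
      split_ifs with h <;> simp [h]
    rw [← e1]
    exact (summable_transition_mul hκ hv adm' j).hasSum
  · have := hasSum_transport hκ hv adm' (hD z hz)
    have e2 := congrArg conj (s1 z hz k)
    rw [transport, Complex.conj_tsum] at e2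
    simp only [map_mul, Complex.conj_conj, map_pow, Complex.conj_ofReal] at e2
    rwa [e2] at this
  · convert! hasSum_single k (f := fun j => (if j = k then (coeff κ k : ℂ) else 0) * z ^ j)
      (fun j hj => by simp [hj]) using 1
    simp

end Transition

/-! ### Behaviour at the boundary -/

section Boundary

variable {κ : ℝ}

/-- The value of the covariance kernel at a nonnegative real number. -/
noncomputable def kernelSum (κ t : ℝ) : ℝ := ∑' n, coeff κ n ^ 2 * t ^ n

lemma ofReal_kernelSum (hκ : κ ≤ 0) {t : ℝ} (ht : 0 ≤ t) (ht' : 0 < 1 + κ * t) :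
    (kernelSum κ t : ℂ) = Complex.exp (logKernel κ t) := by
  have h := hasSum_kernel hκ (t := (t : ℂ)) (by simpa [abs_of_nonneg ht] using ht')
  rw [← h.tsum_eq, kernelSum, Complex.ofReal_tsum]
  simp

lemma summable_kernelSum (hκ : κ ≤ 0) {t : ℝ} (ht : 0 ≤ t) (ht' : 0 < 1 + κ * t) :
    Summable fun n => coeff κ n ^ 2 * t ^ n := by
  have h := hasSum_kernel hκ (t := (t : ℂ)) (by simpa [abs_of_nonneg ht] using ht')
  exact_mod_cast h.summable

lemma kernelSum_mono (hκ : κ ≤ 0) {s t : ℝ} (hs : 0 ≤ s) (hst : s ≤ t) (ht' : 0 < 1 + κ * t) :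
    kernelSum κ s ≤ kernelSum κ t := by
  have hs' : 0 < 1 + κ * s := by nlinarith
  refine (summable_kernelSum hκ hs hs').tsum_le_tsum (fun n => ?_)
    (summable_kernelSum hκ (hs.trans hst) ht')
  gcongr

lemma kernelSum_pos (hκ : κ ≤ 0) {t : ℝ} (ht : 0 ≤ t) (ht' : 0 < 1 + κ * t) :
    0 < kernelSum κ t := by
  refine (summable_kernelSum hκ ht ht').tsum_pos (fun n => by positivity) 0 ?_
  simp [coeff_zero]

lemma hasSum_norm_transported_sq (hκ : κ ≤ 0) {v z : ℂ} (hv : 0 < 1 + κ * ‖v‖ ^ 2)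
    (hz : 0 < 1 + κ * ‖z‖ ^ 2) :
    HasSum (fun n => ‖transported κ v n z‖ ^ 2) (kernelSum κ (‖z‖ ^ 2)) := by
  have h := hasSum_transported_mul_conj hκ hv hz hz
  simp only [Complex.mul_conj'] at h
  rw [← Complex.ofReal_pow, ← ofReal_kernelSum hκ (by positivity) hz] at h
  exact_mod_cast h

lemma coeff_zero_left_sq (n : ℕ) : coeff 0 n ^ 2 = (n.factorial : ℝ)⁻¹ := by
  induction n with
  | zero => simp [coeff_zero]
  | succ n ih =>
    rw [coeff_succ_sq le_rfl, ih, Nat.factorial_succ]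
    push_cast
    have : (n.factorial : ℝ) ≠ 0 := by positivity
    have : (n : ℝ) + 1 ≠ 0 := by positivity
    field_simp
    simp

/-- The function t^n exp(-t) peaks at t = n, so Stirling's lower bound for n! gives an estimate
uniform in t. -/
lemma pow_div_factorial_le {n : ℕ} (hn : 0 < n) {t : ℝ} (ht : 0 ≤ t) :
    t ^ n / n.factorial ≤ Real.exp t / √(2 * Real.pi * n) := by
  have hn' : (0 : ℝ) < n := by exact_mod_cast hn
  have h1 := Stirling.le_factorial_stirling n
  have h2 : t ^ n ≤ Real.exp t * (n / Real.exp 1) ^ n := by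
    -- This is x + 1 ≤ exp x at x = t/n - 1.
    have h3 : t ≤ n * Real.exp (t / n - 1) := by
      have := Real.add_one_le_exp (t / n - 1)
      rw [sub_add_cancel, div_le_iff₀ hn'] at this
      linarith
    calc t ^ n ≤ (n * Real.exp (t / n - 1)) ^ n := by gcongr
      _ = _ := by
        rw [mul_pow, ← Real.exp_nat_mul, div_pow, ← Real.exp_nat_mul, mul_sub,
          mul_div_cancel₀ _ hn'.ne',
          Real.exp_sub]
        ring
  have h4 : 0 < √(2 * Real.pi * n) := by positivity
  have h5 : (0 : ℝ) < n.factorial := by positivity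
  rw [div_le_div_iff₀ h5 h4]
  calc t ^ n * √(2 * Real.pi * n) ≤ Real.exp t * (n / Real.exp 1) ^ n * √(2 * Real.pi * n) := by
        gcongr
    _ = Real.exp t * (√(2 * Real.pi * n) * (n / Real.exp 1) ^ n) := by ring
    _ ≤ _ := by gcongr

lemma kernelSum_zero_left (t : ℝ) (ht : 0 ≤ t) : kernelSum 0 t = Real.exp t := by
  have := ofReal_kernelSum le_rfl ht (by simp)
  simp only [logKernel, if_true] at this
  exact_mod_cast this

/-- The shares are Poisson probabilities with parameter t. Indices n ≥ N + 1 are handled by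
Stirling, uniformly in t; each of the finitely many others decays as t → ∞. -/
lemma exists_coeff_sq_mul_pow_le_of_zero {ε : ℝ} (hε : 0 < ε) :
    ∃ M, ∀ t, 0 ≤ t → M ≤ t → ∀ n, coeff 0 n ^ 2 * t ^ n ≤ ε * kernelSum 0 t := by
  have h1 : Tendsto (fun n : ℕ => (√(2 * Real.pi * n))⁻¹) atTop (𝓝 0) :=
    tendsto_inv_atTop_zero.comp (Real.tendsto_sqrt_atTop.comp
      (tendsto_natCast_atTop_atTop.const_mul_atTop (by positivity)))
  obtain ⟨N, hN⟩ := eventually_atTop.mp (h1.eventually_le_const hε)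
  have h2 : ∀ᶠ t : ℝ in atTop, ∀ n ∈ Finset.range (N + 1), t ^ n * Real.exp (-t) ≤ ε := by
    rw [eventually_all_finset]
    intro n _
    exact (Real.tendsto_pow_mul_exp_neg_atTop_nhds_zero n).eventually_le_const hε
  obtain ⟨M, hM⟩ := eventually_atTop.mp h2
  refine ⟨M, fun t ht0 ht n => ?_⟩
  rw [coeff_zero_left_sq, kernelSum_zero_left t ht0, inv_mul_eq_div]
  by_cases hn : n < N + 1
  · have h3 := hM t ht n (Finset.mem_range.mpr hn)
    rw [Real.exp_neg, ← div_eq_mul_inv, div_le_iff₀ (Real.exp_pos t)] at h3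
    refine (div_le_self (by positivity) ?_).trans h3
    exact_mod_cast Nat.one_le_iff_ne_zero.mpr n.factorial_ne_zero
  · refine (pow_div_factorial_le (by omega) ht0).trans ?_
    rw [div_eq_mul_inv, mul_comm]
    gcongr
    exact hN n (by omega)

/-- For κ ≥ -1 the ratios a_{n+1}²/a_n² are at least -κ. The terms from index n onwards therefore
dominate a geometric series of ratio -κt started at the n-th term. -/
lemma coeff_sq_mul_pow_le_of_neg_one_le (hκ : κ ≤ 0) (hκ' : -1 ≤ κ) {t : ℝ} (ht : 0 ≤ t)
    (ht' : 0 < 1 + κ * t) (n : ℕ) : coeff κ n ^ 2 * t ^ n ≤ (1 + κ * t) * kernelSum κ t := by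
  have h1 : ∀ j, (-κ) ^ j * coeff κ n ^ 2 ≤ coeff κ (n + j) ^ 2 := by
    intro j
    induction j with
    | zero => simp
    | succ j ih =>
      have h : -κ ≤ (1 - (n + j : ℕ) * κ) / ((n + j : ℕ) + 1) := by
        rw [le_div_iff₀ (by positivity)]
        nlinarith
      have h' : (0 : ℝ) ≤ -κ := by linarith
      rw [← add_assoc, coeff_succ_sq hκ, pow_succ]
      calc (-κ) ^ j * -κ * coeff κ n ^ 2 = ((-κ) ^ j * coeff κ n ^ 2) * (-κ) := by ring
        _ ≤ _ := by gcongr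
  have hq : 0 ≤ -κ * t := mul_nonneg (by linarith) ht
  have hg : HasSum (fun j : ℕ => (-κ * t) ^ j) (1 - -κ * t)⁻¹ :=
    hasSum_geometric_of_lt_one hq (by linarith)
  have h2 := (hg.mul_left (coeff κ n ^ 2 * t ^ n))
  have h3 : coeff κ n ^ 2 * t ^ n * (1 - -κ * t)⁻¹ ≤ kernelSum κ t := by
    rw [← h2.tsum_eq]
    refine Summable.tsum_le_tsum_of_inj (fun j => n + j) (add_right_injective n)
      (fun m _ => by positivity) (fun j => ?_) h2.summable (summable_kernelSum hκ ht ht')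
    calc coeff κ n ^ 2 * t ^ n * (-κ * t) ^ j
        = ((-κ) ^ j * coeff κ n ^ 2) * t ^ (n + j) := by rw [mul_pow, pow_add]; ring
      _ ≤ _ := by gcongr; exact h1 j
  have h4 : 1 - -κ * t = 1 + κ * t := by ring
  rw [h4, ← div_eq_mul_inv, div_le_iff₀ ht'] at h3
  linarith

lemma exists_coeff_sq_mul_pow_le_of_neg (hκ : κ < 0) {ε : ℝ} (hε : 0 < ε) :
    ∃ δ, 0 < δ ∧ ∀ t, 0 ≤ t → 0 < 1 + κ * t → 1 + κ * t ≤ δ → ∀ n,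
      coeff κ n ^ 2 * t ^ n ≤ ε * kernelSum κ t := by
  by_cases h1 : -1 ≤ κ
  · refine ⟨ε, hε, fun t ht ht' hδ n =>
      (coeff_sq_mul_pow_le_of_neg_one_le hκ.le h1 ht ht' n).trans ?_⟩
    have := kernelSum_pos hκ.le ht ht'
    gcongr
  -- For κ < -1 the ratios are at most -κ, so every term is at most 1, while the sum (1 + κt)^(1/κ)
  -- diverges at the boundary. The witness is ε^(-κ), the value of 1 + κt at which this sum equals
  -- 1/ε.
  · refine ⟨Real.exp (κ * Real.log ε⁻¹), Real.exp_pos _, fun t ht ht' hδ n => ?_⟩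
    have h2 : coeff κ n ^ 2 ≤ (-κ) ^ n := by
      induction n with
      | zero => simp [coeff_zero]
      | succ n ih =>
        rw [coeff_succ_sq hκ.le, pow_succ]
        have := one_sub_natCast_mul_pos hκ.le n
        have h : (1 - n * κ) / ((n : ℝ) + 1) ≤ -κ := by
          rw [div_le_iff₀ (by positivity)]
          nlinarith
        exact mul_le_mul ih h (by positivity) (pow_nonneg (by linarith) n)
    have h3 : coeff κ n ^ 2 * t ^ n ≤ 1 := by
      calc coeff κ n ^ 2 * t ^ n ≤ (-κ) ^ n * t ^ n := by gcongr
        _ = (-κ * t) ^ n := (mul_pow _ _ _).symm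
        _ ≤ 1 := pow_le_one₀ (mul_nonneg (by linarith) ht) (by linarith)
    have h4 : kernelSum κ t = Real.exp (Real.log (1 + κ * t) / κ) := by
      have := ofReal_kernelSum hκ.le ht ht'
      simp only [logKernel, hκ.ne, if_false] at this
      have e : (1 + κ * t : ℂ) = ((1 + κ * t : ℝ) : ℂ) := by push_cast; rfl
      rw [e, ← Complex.ofReal_log ht'.le] at this
      exact_mod_cast this
    have h5 : ε⁻¹ ≤ kernelSum κ t := by
      rw [h4, ← Real.exp_log (inv_pos.mpr hε), Real.exp_le_exp, le_div_iff_of_neg hκ, 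
        ← Real.log_exp (Real.log ε⁻¹ * κ)]
      exact Real.log_le_log ht' (by rwa [mul_comm _ κ])
    refine h3.trans ?_
    rwa [inv_le_iff_one_le_mul₀' hε] at h5

/-- Allows convergence along |u| → ρ to be tested on sequences. -/
instance : (toBoundary κ).IsCountablyGenerated := by
  unfold toBoundary; infer_instance

lemma eventually_le_norm_toBoundary_zero (M : ℝ) :
    ∀ᶠ u : disk 0 in toBoundary 0, M ≤ ‖(u : ℂ)‖ := by
  have h1 : Tendsto (fun u : disk 0 => ‖(u : ℂ)‖ₑ) (toBoundary 0) (𝓝 ⊤) := by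
    have : radius 0 = ⊤ := by simp [radius, ENNReal.zero_rpow_of_neg]
    rw [← this]
    exact tendsto_comap
  filter_upwards [h1.eventually_const_le (ENNReal.ofReal_lt_top (r := M))] with u hu
  rw [← ofReal_norm] at hu
  exact (ENNReal.ofReal_le_ofReal_iff (norm_nonneg _)).mp hu

lemma tendsto_one_add_mul_sq_toBoundary (hκ : κ < 0) :
    Tendsto (fun u : disk κ => 1 + κ * ‖(u : ℂ)‖ ^ 2) (toBoundary κ) (𝓝 0) := by
  have h0 : 0 < |κ| := abs_pos.mpr hκ.ne
  have h1 : Tendsto (fun u : disk κ => ‖(u : ℂ)‖ₑ) (toBoundary κ) (𝓝 (radius κ)) := tendsto_comap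
  have hr : radius κ = ENNReal.ofReal ((√|κ|)⁻¹) := by
    rw [radius, ENNReal.ofReal_rpow_of_pos h0, Real.rpow_neg h0.le, Real.sqrt_eq_rpow]
  have h2 := (ENNReal.tendsto_toReal (a := radius κ)
    (by rw [hr]; exact ENNReal.ofReal_ne_top)).comp h1
  rw [hr, ENNReal.toReal_ofReal (by positivity)] at h2
  have h3 : Tendsto (fun u : disk κ => ‖(u : ℂ)‖) (toBoundary κ) (𝓝 (√|κ|)⁻¹) := by
    refine h2.congr fun u => ?_
    simp [Function.comp, toReal_enorm]
  have h4 := ((h3.pow 2).const_mul κ).const_add 1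
  convert! h4 using 2
  rw [inv_pow, Real.sq_sqrt h0.le, abs_of_neg hκ]
  rw [inv_neg, mul_neg, mul_inv_cancel₀ hκ.ne, add_neg_cancel]

/-- The map Φ^{-u} carries |z| ≤ r uniformly towards the boundary as |u| → ρ, where the share of
every term in the kernel series is small. -/
lemma eventually_coeff_sq_mul_pow_le (hκ : κ ≤ 0) {r ε : ℝ} (hr' : 0 < 1 + κ * r ^ 2)
    (hε : 0 < ε) : ∀ᶠ u : disk κ in toBoundary κ, ∀ z, ‖z‖ ≤ r → ∀ n,
      coeff κ n ^ 2 * (‖mobius κ (-u) z‖ ^ 2) ^ n ≤ ε * kernelSum κ (‖mobius κ (-u) z‖ ^ 2) := by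
  rcases hκ.eq_or_lt with rfl | hκ0
  · obtain ⟨M, hM⟩ := exists_coeff_sq_mul_pow_le_of_zero hε
    -- For κ = 0 the map is a translation. Having |z + u| ≥ 1 as well as |z + u| ≥ M ensures |z +
    -- u|² ≥ M.
    filter_upwards [eventually_le_norm_toBoundary_zero (r + max M 1)] with u hu z hz n
    refine hM _ (by positivity) ?_ n
    have h1 : mobius 0 (-u) z = z + u := by simp [mobius]
    have h2 : ‖(u : ℂ)‖ - ‖z‖ ≤ ‖z + u‖ := by
      have := norm_sub_norm_le (u : ℂ) (-z)
      rwa [norm_neg, sub_neg_eq_add, add_comm (u : ℂ)] at this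
    have h3 : max M 1 ≤ ‖z + u‖ := by linarith
    rw [h1]
    nlinarith [le_max_left M 1, le_max_right M 1]
  · obtain ⟨δ, hδ, h⟩ := exists_coeff_sq_mul_pow_le_of_neg hκ0 hε
    have hc : 0 < (1 + κ * r ^ 2) / 2 := by linarith
    filter_upwards [(tendsto_one_add_mul_sq_toBoundary hκ0).eventually_le_const
      (show 0 < δ * ((1 + κ * r ^ 2) / 2) ^ 2 by positivity)] with u hu z hz n
    have hu0 : 0 < 1 + κ * ‖(-u : ℂ)‖ ^ 2 := by simpa using (mem_disk_iff hκ).mp u.2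
    have hz0 := ball_subset_of_pos hκ hr' hz
    refine h _ (by positivity) (mobius_mem hκ hu0 hz0) ?_ n
    rw [one_add_mul_norm_mobius_sq hκ hu0 hz0]
    -- Since |u||z| ≤ (|u|² + |z|²)/2, the modulus is at least the mean of 1 + κ|u|² and 1 + κ|z|²;
    -- the former is positive and the latter is at least 1 + κr².
    have hD : (1 + κ * r ^ 2) / 2 ≤ ‖1 + κ * conj (-u : ℂ) * z‖ := by
      have h1 := norm_sub_norm_le (1 : ℂ) (-(κ * conj (-u : ℂ) * z))
      rw [norm_one, norm_neg, sub_neg_eq_add, norm_mul, norm_mul, Complex.norm_real,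
        RCLike.norm_conj, Real.norm_of_nonpos hκ] at h1
      have h2 : ‖z‖ ^ 2 ≤ r ^ 2 := by gcongr
      nlinarith [sq_nonneg (‖(-u : ℂ)‖ - ‖z‖),
        mul_nonneg (neg_nonneg.mpr hκ) (sq_nonneg (‖(-u : ℂ)‖ - ‖z‖))]
    rw [div_le_iff₀ (by have := hc.trans_le hD; positivity)]
    calc (1 + κ * ‖(-u : ℂ)‖ ^ 2) * (1 + κ * ‖z‖ ^ 2) ≤ (1 + κ * ‖(-u : ℂ)‖ ^ 2) * 1 := by
          gcongr
          nlinarith [sq_nonneg ‖z‖]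
      _ ≤ δ * ((1 + κ * r ^ 2) / 2) ^ 2 := by simpa using hu
      _ ≤ _ := by gcongr

/-- The entries of each row of the transition matrix become uniformly small at the boundary. -/
lemma eventually_norm_transition_le (hκ : κ ≤ 0) (k : ℕ) {ε : ℝ} (hε : 0 < ε) :
    ∀ᶠ u : disk κ in toBoundary κ, ∀ n, ‖transition κ (-(u : ℂ)) k n‖ ≤ ε := by
  obtain ⟨r, hr, hr'⟩ := exists_gt_one_add_mul_sq_pos (κ := κ) (s := 0) (by simp)
  have hE := kernelSum_pos hκ (sq_nonneg r) hr'
  have h0 : 0 < coeff κ k * r ^ k := mul_pos (coeff_pos hκ k) (pow_pos hr k)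
  have hε' : 0 < (ε * (coeff κ k * r ^ k)) ^ 2 / kernelSum κ (r ^ 2) := by positivity
  filter_upwards [eventually_coeff_sq_mul_pow_le hκ hr' hε'] with u hu n
  have hu0 : 0 < 1 + κ * ‖(-u : ℂ)‖ ^ 2 := by simpa using (mem_disk_iff hκ).mp u.2
  have key : ∀ z, ‖z‖ ≤ r → ‖transported κ (-u) n z‖ ≤ ε * (coeff κ k * r ^ k) := by
    intro z hz
    have hz0 := ball_subset_of_pos hκ hr' hz
    have e1 : ∀ n, ‖transported κ (-u) n z‖ ^ 2 =
        coeff κ n ^ 2 * (‖mobius κ (-u) z‖ ^ 2) ^ n * ‖weight κ (-u) z‖ ^ 2 := by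
      intro n
      rw [transported, norm_mul, norm_mul, norm_pow, Complex.norm_real, mul_pow, mul_pow,
        Real.norm_eq_abs, sq_abs]
      ring
    -- Summing `e1` over n and using invariance: the weight rescales every term alike, so
    -- |transported|² is the share of the n-th term times K(|z|²) ≤ K(r²).
    have e2 : kernelSum κ (‖z‖ ^ 2) = kernelSum κ (‖mobius κ (-u) z‖ ^ 2) *
        ‖weight κ (-u) z‖ ^ 2 := by
      rw [← (hasSum_norm_transported_sq hκ hu0 hz0).tsum_eq, kernelSum, ← tsum_mul_right]
      exact tsum_congr e1
    rw [← pow_le_pow_iff_left₀ (norm_nonneg _) (by positivity) two_ne_zero, e1]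
    calc coeff κ n ^ 2 * (‖mobius κ (-u) z‖ ^ 2) ^ n * ‖weight κ (-u) z‖ ^ 2
        ≤ ((ε * (coeff κ k * r ^ k)) ^ 2 / kernelSum κ (r ^ 2) *
            kernelSum κ (‖mobius κ (-u) z‖ ^ 2)) * ‖weight κ (-u) z‖ ^ 2 := by
          exact mul_le_mul_of_nonneg_right (hu z hz n) (sq_nonneg _)
      _ = (ε * (coeff κ k * r ^ k)) ^ 2 / kernelSum κ (r ^ 2) * kernelSum κ (‖z‖ ^ 2) := by
          rw [e2]; ring
      _ ≤ (ε * (coeff κ k * r ^ k)) ^ 2 / kernelSum κ (r ^ 2) * kernelSum κ (r ^ 2) := by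
          gcongr
          exact kernelSum_mono hκ (by positivity) (by gcongr) hr'
      _ = _ := div_mul_cancel₀ _ hE.ne'
  have := norm_transition_le hκ hu0 hr hr' n key k
  rw [mul_right_comm, mul_comm] at this
  exact le_of_mul_le_mul_right this h0

end Boundary

/-! ### Zeros of a transported power series -/

section Zeros

variable {κ : ℝ}

lemma analyticAt_powerSeriesFun (hκ : κ ≤ 0) {x : ℕ → ℂ} (hx : Admissible κ x) {z : ℂ}
    (hz : 0 < 1 + κ * ‖z‖ ^ 2) : AnalyticAt ℂ (powerSeriesFun κ x) z := by
  obtain ⟨R, hzR, hR⟩ := exists_gt_one_add_mul_sq_pos hz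
  have hd : DifferentiableOn ℂ (powerSeriesFun κ x) (Metric.ball 0 R) := by
    refine Complex.differentiableOn_tsum_of_summable_norm
      (hx R ((norm_nonneg z).trans hzR.le) hR) (fun n => by fun_prop) Metric.isOpen_ball
      (fun n w hw => ?_)
    have := coeff_pos hκ n
    rw [norm_mul, norm_mul, norm_pow, Complex.norm_real, Real.norm_of_nonneg this.le,
      mul_comm (coeff κ n), mul_assoc]
    gcongr
    exact (mem_ball_zero_iff.mp hw).le
  exact hd.analyticAt (Metric.isOpen_ball.mem_nhds (by simpa using hzR))

lemma powerSeriesFun_transport (hκ : κ ≤ 0) {v z : ℂ} (hv : 0 < 1 + κ * ‖v‖ ^ 2)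
    {x : ℕ → ℂ} (hx : Admissible κ x) (hz : 0 < 1 + κ * ‖z‖ ^ 2) :
    powerSeriesFun κ (transport κ v x) z =
      powerSeriesFun κ x (mobius κ v z) * weight κ v z := by
  rw [powerSeriesFun, (hasSum_transport hκ hv hx hz).tsum_eq, powerSeriesFun, ← tsum_mul_right]
  refine tsum_congr fun n => ?_
  rw [transported]
  ring

/-- Multiplicities survive because the weight has no zeros and the Möbius map has nonzero
derivative. -/
lemma analyticOrderAt_powerSeriesFun_transport (hκ : κ ≤ 0) {v z : ℂ}
    (hv : 0 < 1 + κ * ‖v‖ ^ 2) {x : ℕ → ℂ} (hx : Admissible κ x) (hz : 0 < 1 + κ * ‖z‖ ^ 2) :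
    analyticOrderAt (powerSeriesFun κ (transport κ v x)) z =
      analyticOrderAt (powerSeriesFun κ x) (mobius κ v z) := by
  have hopen : ∀ᶠ w in 𝓝 z, 0 < 1 + κ * ‖w‖ ^ 2 := by
    have : ContinuousAt (fun w : ℂ => 1 + κ * ‖w‖ ^ 2) z := by fun_prop
    exact this.eventually_const_lt hz
  have h1 : powerSeriesFun κ (transport κ v x) =ᶠ[𝓝 z]
      (powerSeriesFun κ x ∘ mobius κ v) * weight κ v := by
    filter_upwards [hopen] with w hw
    exact powerSeriesFun_transport hκ hv hx hw
  have hm : AnalyticAt ℂ (mobius κ v) z := by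
    rw [Complex.analyticAt_iff_eventually_differentiableAt]
    filter_upwards [hopen] with w hw
    exact (hasDerivAt_mobius hκ hv hw).differentiableAt
  have hw : AnalyticAt ℂ (weight κ v) z := by
    rw [Complex.analyticAt_iff_eventually_differentiableAt]
    filter_upwards [hopen] with w hw
    exact differentiableAt_weight hκ hv hw
  have hf := analyticAt_powerSeriesFun hκ hx (mobius_mem hκ hv hz)
  rw [analyticOrderAt_congr h1, analyticOrderAt_mul (hf.comp hm) hw,
    hw.analyticOrderAt_eq_zero.mpr (weight_ne_zero v z), add_zero,
    analyticOrderAt_comp_of_deriv_ne_zero hm]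
  rw [(hasDerivAt_mobius hκ hv hz).deriv]
  exact div_ne_zero (one_add_mul_conj_mul_self_ne_zero hv)
    (pow_ne_zero 2 (mobius_denom_ne_zero hκ hv hz))

/-- The linear statistic of `φ ∘ Φ^u` is the linear statistic of `φ` for the transported series. -/
lemma linearStatistic_comp_mobius (hκ : κ ≤ 0) {u : ℂ} (hu : 0 < 1 + κ * ‖u‖ ^ 2)
    {x : ℕ → ℂ} (hx : Admissible κ x) (φ : ℂ → ℂ) :
    linearStatistic κ x (fun ξ => φ (mobius κ u ξ)) =
      linearStatistic κ (transport κ (-u) x) φ := by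
  have hu' : 0 < 1 + κ * ‖-u‖ ^ 2 := by simpa using hu
  have key : ∀ ξ, ξ ∈ disk κ → mobius κ u ξ ∈ disk κ ∧
      mobius κ (-u) (mobius κ u ξ) = ξ := fun ξ hξ => by
    rw [mem_disk_iff hκ] at *
    exact ⟨mobius_mem hκ hu hξ, mobius_neg_mobius hκ hu hξ⟩
  have key' : ∀ ξ, ξ ∈ disk κ → mobius κ (-u) ξ ∈ disk κ ∧
      mobius κ u (mobius κ (-u) ξ) = ξ := fun ξ hξ => by
    rw [mem_disk_iff hκ] at *
    refine ⟨mobius_mem hκ hu' hξ, ?_⟩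
    have := mobius_neg_mobius hκ hu' hξ
    rwa [neg_neg] at this
  unfold linearStatistic
  refine finsum_mem_eq_of_bijOn (mobius κ u) ⟨fun ξ hξ => ?_, fun a ha b hb hab => ?_,
    fun ξ hξ => ⟨mobius κ (-u) ξ, ?_, (key' ξ hξ.1).2⟩⟩ fun ξ hξ => ?_
  · obtain ⟨h1, h2⟩ := key ξ hξ.1
    refine ⟨h1, ?_⟩
    rw [powerSeriesFun_transport hκ hu' hx ((mem_disk_iff hκ).mp h1), h2, hξ.2, zero_mul]
  · rw [← (key a ha.1).2, ← (key b hb.1).2, hab]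
  · obtain ⟨h1, h2⟩ := key' ξ hξ.1
    refine ⟨h1, ?_⟩
    have h3 := hξ.2
    rw [powerSeriesFun_transport hκ hu' hx ((mem_disk_iff hκ).mp hξ.1)] at h3
    exact (mul_eq_zero.mp h3).resolve_right (weight_ne_zero _ _)
  · obtain ⟨h1, h2⟩ := key ξ hξ.1
    rw [analyticOrderNatAt, analyticOrderNatAt,
      analyticOrderAt_powerSeriesFun_transport hκ hu' hx ((mem_disk_iff hκ).mp h1), h2]

/-- If the test function is supported in the disk, the sum may be extended to all points. -/
lemma linearStatistic_eq_finsum {x : ℕ → ℂ} {φ : ℂ → ℂ} (hφ : tsupport φ ⊆ disk κ) :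
    linearStatistic κ x φ =
      ∑ᶠ ξ, (analyticOrderNatAt (powerSeriesFun κ x) ξ : ℂ) * φ ξ := by
  classical
  unfold linearStatistic
  refine finsum_congr fun ξ => ?_
  by_cases h : ξ ∈ {ξ : ℂ | ξ ∈ disk κ ∧ powerSeriesFun κ x ξ = 0}
  · rw [finsum_eq_if, if_pos h]
  · rw [finsum_eq_if, if_neg h]
    symm
    rw [mul_eq_zero]
    by_cases h1 : powerSeriesFun κ x ξ = 0
    · right
      exact image_eq_zero_of_notMem_tsupport fun h2 => h ⟨hφ h2, h1⟩
    · left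
      by_contra h2
      exact h1 (apply_eq_zero_of_analyticOrderNatAt_ne_zero (by exact_mod_cast h2))

end Zeros

/-! ### Continuity of sums over zeros -/

section Hurwitz

open Metric

lemma finite_zeros_of_compact {f : ℂ → ℂ} {R : ℝ} {K : Set ℂ} (hf : AnalyticOnNhd ℂ f (ball 0 R))
    (hne : ∃ z ∈ ball (0 : ℂ) R, f z ≠ 0) (hK : IsCompact K) (hKR : K ⊆ ball 0 R) :
    {z ∈ K | f z = 0}.Finite := by
  obtain ⟨z, hz, hfz⟩ := hne
  have h1 := hf.preimage_zero_mem_codiscreteWithin hfz hz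
    ⟨⟨z, hz⟩, (convex_ball (0 : ℂ) R).isPreconnected⟩
  refine (hK.finite_sdiff_of_mem_codiscreteWithin (codiscreteWithin_mono hKR h1)).subset ?_
  rintro w ⟨hw, hw0⟩
  exact ⟨hw, by simpa using hw0⟩

/-- The number of zeros of an analytic function in a disk, as a difference of circle averages. -/
lemma circleAverage_sub_circleAverage_eq {f : ℂ → ℂ} {c : ℂ} {R₁ R₂ : ℝ} (hR₁ : 0 < R₁)
    (hR : R₁ < R₂) (hf : AnalyticOnNhd ℂ f (closedBall c R₂))
    (hne : ∀ z ∈ closedBall c R₂, z ∉ ball c R₁ → f z ≠ 0) {S : Finset ℂ}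
    (hS : ∀ z, z ∈ S ↔ z ∈ closedBall c R₂ ∧ f z = 0) :
    Real.circleAverage (fun z => Real.log ‖f z‖) c R₂ -
      Real.circleAverage (fun z => Real.log ‖f z‖) c R₁ =
        (∑ ξ ∈ S, (analyticOrderNatAt f ξ : ℝ)) * (Real.log R₂ - Real.log R₁) := by
  classical
  have hR₂ : 0 < R₂ := hR₁.trans hR
  have htop : ∀ z ∈ closedBall c R₂, analyticOrderAt f z ≠ ⊤ := by
    intro z hz
    have hw : c + R₂ ∈ closedBall c R₂ := by simp [abs_of_pos hR₂]
    refine hf.analyticOrderAt_ne_top_of_isPreconnected (convex_closedBall c R₂).isPreconnected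
      hw hz ?_
    rw [(hf _ hw).analyticOrderAt_eq_zero.mpr]
    · simp
    · exact hne _ hw (by simp [abs_of_pos hR₂, hR.le])
  -- There are no zeros in the closed annulus, so the divisor is the same for all radii between R₁
  -- and R₂.
  have hdiv : ∀ (ρ : ℝ), R₁ ≤ ρ → ρ ≤ R₂ → ∀ z,
      MeromorphicOn.divisor f (closedBall c ρ) z = (analyticOrderNatAt f z : ℤ) *
        if z ∈ closedBall c R₂ then 1 else 0 := by
    intro ρ h1 h2 z
    have hρ : closedBall c ρ ⊆ closedBall c R₂ := closedBall_subset_closedBall h2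
    by_cases hz : z ∈ closedBall c ρ
    · rw [MeromorphicOn.AnalyticOnNhd.divisor_apply (hf.mono hρ) hz, if_pos (hρ hz), mul_one,
        ← Nat.cast_analyticOrderNatAt (htop z (hρ hz))]
      simp
    · rw [Function.locallyFinsuppWithin.apply_eq_zero_of_notMem _ hz]
      split_ifs with h
      · have : f z ≠ 0 := hne z h fun h' => hz (closedBall_subset_closedBall h1
          (ball_subset_closedBall h'))
        rw [analyticOrderNatAt, (hf z h).analyticOrderAt_eq_zero.mpr this]
        simp
      · simp
  -- Jensen's formula. Only log ρ depends on the radius, so the remaining terms cancel in the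
  -- difference. A zero at the centre is covered by the convention log 0 = 0.
  have hjensen : ∀ (ρ : ℝ), R₁ ≤ ρ → ρ ≤ R₂ →
      Real.circleAverage (fun z => Real.log ‖f z‖) c ρ =
        ∑ ξ ∈ S, (analyticOrderNatAt f ξ : ℝ) * (Real.log ρ - Real.log ‖c - ξ‖) +
          Real.log ‖meromorphicTrailingCoeffAt f c‖ := by
    intro ρ h1 h2
    have hρ0 : 0 < ρ := hR₁.trans_le h1
    have hρ : closedBall c ρ ⊆ closedBall c R₂ := closedBall_subset_closedBall h2
    have hm : MeromorphicOn f (closedBall c |ρ|) := by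
      rw [abs_of_pos hρ0]
      exact (hf.mono hρ).meromorphicOn
    rw [MeromorphicOn.circleAverage_log_norm hρ0.ne' hm, abs_of_pos hρ0,
      ← countingFunction_finsum_eq_finsum_add hρ0.ne'
        ((MeromorphicOn.divisor f (closedBall c ρ)).finiteSupport (isCompact_closedBall c ρ))]
    congr 1
    rw [finsum_eq_sum_of_support_subset (s := S)]
    · refine Finset.sum_congr rfl fun ξ hξ => ?_
      rw [hdiv ρ h1 h2, if_pos ((hS ξ).mp hξ).1]
      simp
    · intro ξ hξ
      rw [Function.mem_support, hdiv ρ h1 h2] at hξ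
      simp only [Finset.mem_coe, hS]
      by_contra hcon
      apply hξ
      by_cases h : ξ ∈ closedBall c R₂
      · have : f ξ ≠ 0 := fun h0 => hcon ⟨h, h0⟩
        rw [analyticOrderNatAt, (hf ξ h).analyticOrderAt_eq_zero.mpr this]
        simp
      · simp [h]
  rw [hjensen R₂ hR.le le_rfl, hjensen R₁ le_rfl hR.le, add_sub_add_right_eq_sub,
    ← Finset.sum_sub_distrib, Finset.sum_mul]
  exact Finset.sum_congr rfl fun ξ _ => by ring

lemma tendsto_circleAverage_log_norm {ι : Type*} {l : Filter ι} [l.IsCountablyGenerated]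
    {F : ι → ℂ → ℂ} {f : ℂ → ℂ} {c : ℂ} {ρ : ℝ} (hρ : 0 ≤ ρ)
    (hF : ∀ i, ContinuousOn (F i) (sphere c ρ)) (hf : ContinuousOn f (sphere c ρ))
    (hne : ∀ z ∈ sphere c ρ, f z ≠ 0) (hu : TendstoUniformlyOn F f l (sphere c ρ)) :
    Tendsto (fun i => Real.circleAverage (fun z => Real.log ‖F i z‖) c ρ) l
      (𝓝 (Real.circleAverage (fun z => Real.log ‖f z‖) c ρ)) := by
  have hcm : ∀ θ, circleMap c ρ θ ∈ sphere c ρ := fun θ => circleMap_mem_sphere c hρ θ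
  have hcont : ∀ g : ℂ → ℂ, ContinuousOn g (sphere c ρ) →
      Continuous fun θ => g (circleMap c ρ θ) := fun g hg =>
    hg.comp_continuous (continuous_circleMap c ρ) hcm
  obtain ⟨δ, hδ, hδf⟩ : ∃ δ > 0, ∀ z ∈ sphere c ρ, δ ≤ ‖f z‖ := by
    obtain ⟨w, hw, hwm⟩ := (isCompact_sphere c ρ).exists_isMinOn ⟨_, hcm 0⟩ hf.norm
    exact ⟨‖f w‖, norm_pos_iff.mpr (hne w hw), fun z hz => hwm hz⟩
  obtain ⟨M, hM⟩ := (isCompact_sphere c ρ).exists_bound_of_continuousOn hf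
  simp only [Real.circleAverage]
  refine Tendsto.const_smul (intervalIntegral.tendsto_integral_filter_of_dominated_convergence
    (fun _ => max |Real.log (δ / 2)| |Real.log (M + δ / 2)|) ?_ ?_ ?_ ?_) _
  · exact Eventually.of_forall fun i =>
      ((Real.measurable_log.comp (hcont _ (hF i)).norm.measurable).aestronglyMeasurable)
  · filter_upwards [Metric.tendstoUniformlyOn_iff.mp hu (δ / 2) (by positivity)] with i hi
    refine Eventually.of_forall fun θ _ => ?_
    have h1 := hi _ (hcm θ)
    have h2 := hδf _ (hcm θ)
    have h3 := hM _ (hcm θ)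
    rw [dist_eq_norm] at h1
    have h4 := norm_sub_norm_le (f (circleMap c ρ θ)) (F i (circleMap c ρ θ))
    have h5 := norm_sub_norm_le (F i (circleMap c ρ θ)) (f (circleMap c ρ θ))
    rw [norm_sub_rev] at h5
    rw [Real.norm_eq_abs]
    exact abs_le_max_abs_abs (Real.log_le_log (by positivity) (by linarith))
      (Real.log_le_log (by linarith) (by linarith))
  · exact intervalIntegrable_const
  · refine Eventually.of_forall fun θ _ => ?_
    exact ((hu.tendsto_at (hcm θ)).norm).log (norm_ne_zero_iff.mpr (hne _ (hcm θ)))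

lemma eventually_ne_zero_of_tendstoUniformlyOn {ι : Type*} {l : Filter ι} {F : ι → ℂ → ℂ}
    {f : ℂ → ℂ} {K : Set ℂ} (hK : IsCompact K) (hf : ContinuousOn f K)
    (hne : ∀ z ∈ K, f z ≠ 0) (hu : TendstoUniformlyOn F f l K) :
    ∀ᶠ i in l, ∀ z ∈ K, F i z ≠ 0 := by
  rcases K.eq_empty_or_nonempty with rfl | hKne
  · simp
  obtain ⟨w, hw, hwm⟩ := hK.exists_isMinOn hKne hf.norm
  filter_upwards [Metric.tendstoUniformlyOn_iff.mp hu ‖f w‖ (norm_pos_iff.mpr (hne w hw))]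
    with i hi z hz h0
  have h1 := hi z hz
  rw [h0, dist_zero_right] at h1
  exact absurd (hwm hz : ‖f w‖ ≤ ‖f z‖) (not_le.mpr h1)

/-- Hurwitz: the number of zeros in a disk is stable under uniform convergence. -/
lemma eventually_sum_analyticOrderNatAt_eq {ι : Type*} {l : Filter ι} [l.IsCountablyGenerated]
    {F : ι → ℂ → ℂ} {f : ℂ → ℂ} {c : ℂ} {R₁ R₂ : ℝ} (hR₁ : 0 < R₁) (hR : R₁ < R₂)
    (hF : ∀ i, AnalyticOnNhd ℂ (F i) (closedBall c R₂)) (hf : AnalyticOnNhd ℂ f (closedBall c R₂))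
    (hu : TendstoUniformlyOn F f l (closedBall c R₂))
    (hne : ∀ z ∈ closedBall c R₂, z ∉ ball c R₁ → f z ≠ 0) {S : Finset ℂ}
    (hS : ∀ z, z ∈ S ↔ z ∈ closedBall c R₂ ∧ f z = 0) :
    ∀ᶠ i in l, (∀ z ∈ closedBall c R₂, z ∉ ball c R₁ → F i z ≠ 0) ∧
      ∀ T : Finset ℂ, (∀ z, z ∈ T ↔ z ∈ closedBall c R₂ ∧ F i z = 0) →
        ∑ ξ ∈ T, analyticOrderNatAt (F i) ξ = ∑ ξ ∈ S, analyticOrderNatAt f ξ := by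
  have hsph : ∀ ρ, R₁ ≤ ρ → ρ ≤ R₂ → sphere c ρ ⊆ closedBall c R₂ := fun ρ _ h2 =>
    sphere_subset_closedBall.trans (closedBall_subset_closedBall h2)
  have htend : ∀ ρ, R₁ ≤ ρ → ρ ≤ R₂ →
      Tendsto (fun i => Real.circleAverage (fun z => Real.log ‖F i z‖) c ρ) l
      (𝓝 (Real.circleAverage (fun z => Real.log ‖f z‖) c ρ)) := by
    intro ρ h1 h2
    refine tendsto_circleAverage_log_norm (hR₁.le.trans h1)
      (fun i => (hF i).continuousOn.mono (hsph ρ h1 h2)) (hf.continuousOn.mono (hsph ρ h1 h2))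
      (fun z hz => hne z (hsph ρ h1 h2 hz) ?_) (hu.mono (hsph ρ h1 h2))
    rw [mem_sphere] at hz
    simp [hz, h1]
  have hlog : 0 < Real.log R₂ - Real.log R₁ := sub_pos.mpr (Real.log_lt_log hR₁ hR)
  have h3 := ((htend R₂ hR.le le_rfl).sub (htend R₁ le_rfl hR.le)).div_const
    (Real.log R₂ - Real.log R₁)
  rw [circleAverage_sub_circleAverage_eq hR₁ hR hf hne hS, mul_div_cancel_right₀ _ hlog.ne'] at h3
  have hK : IsCompact (closedBall c R₂ \ ball c R₁) :=
    (isCompact_closedBall c R₂).diff isOpen_ball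
  have h4 := eventually_ne_zero_of_tendstoUniformlyOn hK (hf.continuousOn.mono Set.sdiff_subset)
    (fun z hz => hne z hz.1 hz.2) (hu.mono Set.sdiff_subset)
  filter_upwards [h4, Metric.tendsto_nhds.mp h3 1 one_pos] with i h5 h6
  refine ⟨fun z hz hz' => h5 z ⟨hz, hz'⟩, fun T hT => ?_⟩
  rw [circleAverage_sub_circleAverage_eq hR₁ hR (hF i) (fun z hz hz' => h5 z ⟨hz, hz'⟩) hT,
    mul_div_cancel_right₀ _ hlog.ne', Real.dist_eq] at h6
  -- The two counts are integers at distance less than 1.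
  have h7 : |((∑ ξ ∈ T, analyticOrderNatAt (F i) ξ : ℕ) : ℤ) -
      ((∑ ξ ∈ S, analyticOrderNatAt f ξ : ℕ) : ℤ)| < 1 := by exact_mod_cast h6
  rw [Int.abs_lt_one_iff] at h7
  omega

lemma eventually_forall_closedBall {a : ℂ} {p : ℂ → Prop} (h : ∀ᶠ z in 𝓝 a, p z) :
    ∀ᶠ δ : ℝ in 𝓝[>] 0, ∀ z ∈ closedBall a δ, p z := by
  obtain ⟨δ₀, hδ₀, h0⟩ := nhds_basis_closedBall.eventually_iff.mp h
  filter_upwards [Ioc_mem_nhdsGT hδ₀] with δ hδ z hz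
  exact h0 (closedBall_subset_closedBall hδ.2 hz)

/-- The sum of a test function over the zeros depends continuously on the analytic function. -/
theorem tendsto_finsum_analyticOrderNatAt_mul {ι : Type*} {l : Filter ι} [l.IsCountablyGenerated]
    {F : ι → ℂ → ℂ} {f : ℂ → ℂ} {R : ℝ} (hF : ∀ i, AnalyticOnNhd ℂ (F i) (ball 0 R))
    (hf : AnalyticOnNhd ℂ f (ball 0 R)) (hne : ∃ z ∈ ball (0 : ℂ) R, f z ≠ 0)
    (hu : TendstoUniformlyOn F f l (ball 0 R)) {φ : ℂ → ℂ} (hφ : Continuous φ)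
    (hφc : HasCompactSupport φ) (hφs : tsupport φ ⊆ ball 0 R) :
    Tendsto (fun i => ∑ᶠ ξ, (analyticOrderNatAt (F i) ξ : ℂ) * φ ξ) l
      (𝓝 (∑ᶠ ξ, (analyticOrderNatAt f ξ : ℂ) * φ ξ)) := by
  classical
  have hAfin := finite_zeros_of_compact hf hne hφc hφs
  set A : Finset ℂ := hAfin.toFinset with hAdef
  have hA : ∀ z, z ∈ A ↔ z ∈ tsupport φ ∧ f z = 0 := fun z => by simp [hAdef]
  have hAR : ∀ a ∈ A, a ∈ ball (0 : ℂ) R := fun a ha => hφs ((hA a).mp ha).1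
  have hsupp : ∀ (g : ℂ → ℂ) ξ, (analyticOrderNatAt g ξ : ℂ) * φ ξ ≠ 0 →
      ξ ∈ tsupport φ ∧ g ξ = 0 := by
    intro g ξ h
    refine ⟨subset_tsupport φ (right_ne_zero_of_mul h),
      apply_eq_zero_of_analyticOrderNatAt_ne_zero ?_⟩
    exact_mod_cast left_ne_zero_of_mul h
  have hSf : ∑ᶠ ξ, (analyticOrderNatAt f ξ : ℂ) * φ ξ =
      ∑ a ∈ A, (analyticOrderNatAt f a : ℂ) * φ a :=
    finsum_eq_sum_of_support_subset _ fun ξ hξ => (hA ξ).mpr (hsupp f ξ hξ)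
  rw [hSf, Metric.tendsto_nhds]
  intro ε hε
  set m : ℝ := ∑ a ∈ A, (analyticOrderNatAt f a : ℝ) with hm
  have hm0 : 0 ≤ m := Finset.sum_nonneg fun _ _ => Nat.cast_nonneg _
  have hε' : 0 < ε / (m + 1) := by positivity
  -- Disjoint disks isolate the zeros of f in the support of φ, and on each of them φ varies by less
  -- than ε/(m + 1). As m is the total multiplicity, the final error is at most mε/(m + 1) < ε.
  have hδ : ∀ᶠ δ : ℝ in 𝓝[>] 0, ∀ a ∈ A, (∀ z ∈ closedBall a δ, z ∈ ball (0 : ℂ) R) ∧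
      (∀ z ∈ closedBall a δ, z ≠ a → f z ≠ 0) ∧
      (∀ z ∈ closedBall a δ, dist (φ z) (φ a) < ε / (m + 1)) ∧
      ∀ b ∈ A, a ≠ b → Disjoint (closedBall a δ) (closedBall b δ) := by
    rw [eventually_all_finset]
    intro a ha
    refine (eventually_forall_closedBall (isOpen_ball.mem_nhds (hAR a ha))).and
      ((eventually_forall_closedBall ?_).and ((eventually_forall_closedBall
        (Metric.tendsto_nhds.mp (hφ.tendsto a) _ hε')).and ?_))
    · obtain ⟨w, hw, hfw⟩ := hne
      have h1 := hf.analyticOrderAt_ne_top_of_isPreconnected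
        (convex_ball (0 : ℂ) R).isPreconnected hw (hAR a ha)
        (by rw [(hf w hw).analyticOrderAt_eq_zero.mpr hfw]; simp)
      rw [Ne, analyticOrderAt_eq_top] at h1
      exact eventually_nhdsWithin_iff.mp
        (((hf a (hAR a ha)).eventually_eq_zero_or_eventually_ne_zero).resolve_left h1)
    · rw [eventually_all_finset]
      intro b hb
      by_cases hab : a = b
      · simp [hab]
      have hd : 0 < dist a b / 2 := by have := dist_pos.mpr hab; linarith
      filter_upwards [Ioo_mem_nhdsGT hd] with δ hδ _
      exact closedBall_disjoint_closedBall (by linarith [hδ.2])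
  obtain ⟨δ, hδA, hδ0⟩ := (hδ.and self_mem_nhdsWithin).exists
  have hδ0 : 0 < δ := hδ0
  have hcb : ∀ a ∈ A, closedBall a δ ⊆ ball 0 R := fun a ha z hz => (hδA a ha).1 z hz
  have hcount : ∀ᶠ i in l, ∀ a ∈ A, (∀ z ∈ closedBall a δ, z ∉ ball a (δ / 2) → F i z ≠ 0) ∧
      ∀ T : Finset ℂ, (∀ z, z ∈ T ↔ z ∈ closedBall a δ ∧ F i z = 0) →
        ∑ ξ ∈ T, analyticOrderNatAt (F i) ξ = ∑ ξ ∈ {a}, analyticOrderNatAt f ξ := by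
    rw [eventually_all_finset]
    intro a ha
    refine eventually_sum_analyticOrderNatAt_eq (half_pos hδ0) (half_lt_self hδ0)
      (fun i => (hF i).mono (hcb a ha)) (hf.mono (hcb a ha)) (hu.mono (hcb a ha)) ?_ ?_
    · intro z hz hz' h0
      refine (hδA a ha).2.1 z hz ?_ h0
      rintro rfl
      exact hz' (mem_ball_self (half_pos hδ0))
    · intro z
      rw [Finset.mem_singleton]
      constructor
      · rintro rfl
        exact ⟨mem_closedBall_self hδ0.le, ((hA z).mp ha).2⟩
      · rintro ⟨hz, h0⟩
        by_contra hza
        exact (hδA a ha).2.1 z hz hza h0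
  have hK : IsCompact (tsupport φ \ ⋃ a ∈ A, ball a (δ / 2)) :=
    hφc.diff (isOpen_biUnion fun _ _ => isOpen_ball)
  have hKR : tsupport φ \ ⋃ a ∈ A, ball a (δ / 2) ⊆ ball 0 R := Set.sdiff_subset.trans hφs
  have hout := eventually_ne_zero_of_tendstoUniformlyOn hK (hf.continuousOn.mono hKR)
    (fun z hz h0 => hz.2 (Set.mem_biUnion ((hA z).mpr ⟨hz.1, h0⟩)
      (mem_ball_self (half_pos hδ0)))) (hu.mono hKR)
  filter_upwards [hcount, hout] with i hi hiout
  have hZ : ∀ a ∈ A, ∃ Z : Finset ℂ, ∀ z, z ∈ Z ↔ z ∈ closedBall a δ ∧ F i z = 0 := by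
    intro a ha
    have hw : a + δ ∈ closedBall a δ := by simp [abs_of_pos hδ0]
    have hfin := finite_zeros_of_compact (hF i) ⟨a + δ, hcb a ha hw, (hi a ha).1 _ hw
      (by simp [abs_of_pos hδ0, hδ0.le])⟩ (isCompact_closedBall a δ) (hcb a ha)
    exact ⟨hfin.toFinset, fun z => by simp⟩
  choose! Z hZ using hZ
  -- By `hiout`, every zero of F_i in the support of φ lies in one of the disks. Zeros in the disks
  -- but outside the support contribute 0.
  have hSF : ∑ᶠ ξ, (analyticOrderNatAt (F i) ξ : ℂ) * φ ξ =
      ∑ a ∈ A, ∑ ξ ∈ Z a, (analyticOrderNatAt (F i) ξ : ℂ) * φ ξ := by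
    rw [← Finset.sum_biUnion]
    · refine finsum_eq_sum_of_support_subset _ fun ξ hξ => ?_
      obtain ⟨h1, h2⟩ := hsupp (F i) ξ hξ
      by_contra hcon
      refine hiout ξ ⟨h1, fun hmem => hcon ?_⟩ h2
      obtain ⟨a, ha, hξa⟩ := Set.mem_iUnion₂.mp hmem
      simp only [Finset.coe_biUnion, Set.mem_iUnion]
      exact ⟨a, ha, (hZ a ha ξ).mpr ⟨ball_subset_closedBall
        (ball_subset_ball (half_le_self hδ0.le) hξa), h2⟩⟩
    · intro a ha b hb hab
      rw [Function.onFun, Finset.disjoint_left]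
      intro ξ h1 h2
      exact Set.disjoint_left.mp ((hδA a ha).2.2.2 b hb hab) ((hZ a ha ξ).mp h1).1
        ((hZ b hb ξ).mp h2).1
  have hcnt : ∀ a ∈ A, (∑ ξ ∈ Z a, (analyticOrderNatAt (F i) ξ : ℂ)) = analyticOrderNatAt f a := by
    intro a ha
    have := (hi a ha).2 (Z a) (hZ a ha)
    rw [Finset.sum_singleton] at this
    exact_mod_cast this
  rw [hSF, dist_eq_norm, ← Finset.sum_sub_distrib]
  have hterm : ∀ a ∈ A, ‖∑ ξ ∈ Z a, (analyticOrderNatAt (F i) ξ : ℂ) * φ ξ -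
      (analyticOrderNatAt f a : ℂ) * φ a‖ ≤ (analyticOrderNatAt f a : ℝ) * (ε / (m + 1)) := by
    intro a ha
    have hreal : (∑ ξ ∈ Z a, (analyticOrderNatAt (F i) ξ : ℝ)) = analyticOrderNatAt f a := by
      exact_mod_cast hcnt a ha
    rw [← hcnt a ha, Finset.sum_mul, ← Finset.sum_sub_distrib, ← hreal, Finset.sum_mul]
    refine norm_sum_le_of_le _ fun ξ hξ => ?_
    rw [← mul_sub, norm_mul, Complex.norm_natCast, ← dist_eq_norm]
    gcongr
    exact ((hδA a ha).2.2.1 ξ ((hZ a ha ξ).mp hξ).1).le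
  calc _ ≤ ∑ a ∈ A, (analyticOrderNatAt f a : ℝ) * (ε / (m + 1)) := norm_sum_le_of_le _ hterm
    _ = m * (ε / (m + 1)) := by rw [← Finset.sum_mul]
    _ < ε := by
      rw [mul_div_assoc', div_lt_iff₀ (by positivity)]
      nlinarith

end Hurwitz

/-! ### Characteristic functions of weighted sums -/

section CharFun

open Complex

/-- The second order Taylor remainder of the exponential on the imaginary axis. -/
noncomputable def expRemainder (s : ℝ) : ℂ := exp (s * I) - 1 - s * I + s ^ 2 / 2

lemma norm_expRemainder_le_cube {s : ℝ} (hs : |s| ≤ 1) : ‖expRemainder s‖ ≤ |s| ^ 3 := by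
  have hn : ‖(s * I : ℂ)‖ = |s| := by simp
  have h := exp_bound (x := s * I) (by rwa [hn]) (n := 3) (by norm_num)
  rw [hn] at h
  have e : exp (s * I) - ∑ m ∈ Finset.range 3, (s * I : ℂ) ^ m / m.factorial = expRemainder s := by
    simp only [Finset.sum_range_succ, Finset.range_zero, Finset.sum_empty, expRemainder,
      Nat.factorial, mul_pow, I_sq]
    push_cast
    ring
  rw [e] at h
  refine h.trans ?_
  have : ((Nat.succ 3 : ℕ) : ℝ) * ((Nat.factorial 3 : ℕ) * (3 : ℕ) : ℝ)⁻¹ ≤ 1 := by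
    norm_num [Nat.factorial]
  nlinarith [pow_nonneg (abs_nonneg s) 3]

/-- Only second moments are available: this quadratic bound serves as the dominating function, and
the cubic one gives the pointwise limit. -/
lemma norm_expRemainder_le_sq (s : ℝ) : ‖expRemainder s‖ ≤ 4 * s ^ 2 := by
  rcases le_or_gt |s| 1 with hs | hs
  · refine (norm_expRemainder_le_cube hs).trans ?_
    rw [← sq_abs s]
    nlinarith [abs_nonneg s, sq_nonneg |s|]
  · have h1 : ‖exp (s * I) - 1 - s * I + (s : ℂ) ^ 2 / 2‖ ≤ 1 + 1 + |s| + s ^ 2 / 2 := by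
      refine (norm_add_le _ _).trans (add_le_add ((norm_sub_le _ _).trans (add_le_add
        ((norm_sub_le _ _).trans (add_le_add ?_ ?_)) ?_)) ?_)
      · rw [norm_exp_ofReal_mul_I]
      · simp
      · simp
      · simp [sq_abs]
    refine h1.trans ?_
    rw [← sq_abs s]
    nlinarith

lemma continuous_expRemainder : Continuous expRemainder := by
  unfold expRemainder
  fun_prop

variable {Ω : Type*} [MeasurableSpace Ω] {P : Measure Ω}

lemma charFun_map_apply {Y : Ω → ℂ} (hY : AEMeasurable Y P) (t : ℂ) :
    charFun (P.map Y) t = ∫ ω, exp ((inner ℝ (Y ω) t : ℝ) * I) ∂P := by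
  rw [charFun_apply, integral_map hY]
  exact (by fun_prop : Continuous fun x : ℂ => exp ((inner ℝ x t : ℝ) * I)).aestronglyMeasurable

/-- The hypotheses on the common law of the coefficients: mean zero, variance one, with
uncorrelated real and imaginary parts of equal variance. -/
structure IsStandardized (Y : Ω → ℂ) (P : Measure Ω) : Prop where
  memLp : MemLp Y 2 P
  mean : ∫ ω, Y ω ∂P = 0
  var : ∫ ω, ‖Y ω‖ ^ 2 ∂P = 1
  re_im : ∫ ω, (Y ω).re ^ 2 ∂P = ∫ ω, (Y ω).im ^ 2 ∂P
  uncorr : ∫ ω, (Y ω).re * (Y ω).im ∂P = 0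

namespace IsStandardized

variable {Y : Ω → ℂ}

lemma memLp_re (hY : IsStandardized Y P) : MemLp (fun ω => (Y ω).re) 2 P := hY.memLp.re

lemma memLp_im (hY : IsStandardized Y P) : MemLp (fun ω => (Y ω).im) 2 P := hY.memLp.im

lemma integral_re_sq (hY : IsStandardized Y P) : ∫ ω, (Y ω).re ^ 2 ∂P = 1 / 2 := by
  have h1 : ∫ ω, ((Y ω).re ^ 2 + (Y ω).im ^ 2) ∂P = 1 := by
    rw [← hY.var]
    refine integral_congr_ae (Eventually.of_forall fun ω => ?_)
    simp only [← normSq_eq_norm_sq, normSq_apply]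
    ring
  rw [integral_add hY.memLp_re.integrable_sq hY.memLp_im.integrable_sq, ← hY.re_im] at h1
  linarith

lemma integral_inner [IsProbabilityMeasure P] (hY : IsStandardized Y P) (t : ℂ) :
    ∫ ω, (inner ℝ (Y ω) t : ℝ) ∂P = 0 := by
  have hi : Integrable Y P := hY.memLp.integrable one_le_two
  have h := _root_.integral_inner (𝕜 := ℝ) hi t
  rw [hY.mean, inner_zero_right] at h
  simpa only [real_inner_comm] using h

/-- Equal variances and zero correlation make the covariance matrix half the identity, so the
variance in direction t depends only on |t|. -/
lemma integral_inner_sq (hY : IsStandardized Y P) (t : ℂ) :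
    ∫ ω, (inner ℝ (Y ω) t : ℝ) ^ 2 ∂P = ‖t‖ ^ 2 / 2 := by
  have e : ∀ ω, (inner ℝ (Y ω) t : ℝ) ^ 2 = t.re ^ 2 * (Y ω).re ^ 2 + t.im ^ 2 * (Y ω).im ^ 2 +
      2 * t.re * t.im * ((Y ω).re * (Y ω).im) := by
    intro ω
    simp [Complex.inner]
    ring
  have i1 := hY.memLp_re.integrable_sq.const_mul (t.re ^ 2)
  have i2 := hY.memLp_im.integrable_sq.const_mul (t.im ^ 2)
  have i12 : Integrable (fun ω => t.re ^ 2 * (Y ω).re ^ 2 + t.im ^ 2 * (Y ω).im ^ 2) P := i1.add i2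
  have i3 : Integrable (fun ω => 2 * t.re * t.im * ((Y ω).re * (Y ω).im)) P :=
    (hY.memLp_re.integrable_mul hY.memLp_im).const_mul (2 * t.re * t.im)
  simp_rw [e]
  rw [integral_add i12 i3, integral_add i1 i2, integral_const_mul, integral_const_mul,
    integral_const_mul, hY.uncorr, ← hY.re_im, hY.integral_re_sq, ← normSq_eq_norm_sq,
    normSq_apply]
  ring

lemma integrable_norm_sq (hY : IsStandardized Y P) :
    Integrable (fun ω => ‖Y ω‖ ^ 2) P := hY.memLp.norm.integrable_sq

lemma aemeasurable (hY : IsStandardized Y P) :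
    AEMeasurable Y P := hY.memLp.aestronglyMeasurable.aemeasurable

lemma integrable_inner [IsProbabilityMeasure P] (hY : IsStandardized Y P) (t : ℂ) :
    Integrable (fun ω => (inner ℝ (Y ω) t : ℝ)) P :=
  (hY.memLp.integrable one_le_two).inner_const t

lemma integrable_inner_sq (hY : IsStandardized Y P) (t : ℂ) :
    Integrable (fun ω => (inner ℝ (Y ω) t : ℝ) ^ 2) P := by
  have h : MemLp (fun ω => (inner ℝ (Y ω) t : ℝ)) 2 P := hY.memLp.inner_const t
  exact h.integrable_sq

lemma charFun_sub_eq [IsProbabilityMeasure P] (hY : IsStandardized Y P) (t : ℂ) :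
    charFun (P.map Y) t - (1 - ‖t‖ ^ 2 / 4 : ℝ) =
    ∫ ω, expRemainder (inner ℝ (Y ω) t) ∂P := by
  have i1 : Integrable (fun ω => exp ((inner ℝ (Y ω) t : ℝ) * I)) P := by
    refine Integrable.of_bound (C := 1) ?_ (Eventually.of_forall fun ω => ?_)
    · exact (by fun_prop : Continuous fun x : ℂ => exp
      ((inner ℝ x t : ℝ) * I)).comp_aestronglyMeasurable
        hY.memLp.aestronglyMeasurable
    · rw [norm_exp_ofReal_mul_I]
  have i2 : Integrable (fun ω => ((inner ℝ (Y ω) t : ℝ) : ℂ) * I) P :=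
    (hY.integrable_inner t).ofReal.mul_const I
  have i3 : Integrable (fun ω => ((inner ℝ (Y ω) t : ℝ) : ℂ) ^ 2 / 2) P := by
    have := (hY.integrable_inner_sq t).ofReal (𝕜 := ℂ)
    simpa using this.div_const 2
  have e2 : ∫ ω, ((inner ℝ (Y ω) t : ℝ) : ℂ) * I ∂P = 0 := by
    rw [integral_mul_const, integral_complex_ofReal, hY.integral_inner]
    simp
  have e3 : ∫ ω, ((inner ℝ (Y ω) t : ℝ) : ℂ) ^ 2 / 2 ∂P = ((‖t‖ ^ 2 / 4 : ℝ) : ℂ) := by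
    rw [integral_div]
    simp_rw [← ofReal_pow]
    rw [integral_complex_ofReal, hY.integral_inner_sq]
    push_cast
    ring
  have i12 : Integrable (fun ω => exp ((inner ℝ (Y ω) t : ℝ) * I) - 1) P :=
    i1.sub (integrable_const _)
  have i123 : Integrable (fun ω => exp ((inner ℝ (Y ω) t : ℝ) * I) - 1 -
      ((inner ℝ (Y ω) t : ℝ) : ℂ) * I) P := i12.sub i2
  simp only [expRemainder]
  rw [integral_add i123 i3, integral_sub i12 i2, integral_sub i1 (integrable_const _), e2, e3,
    charFun_map_apply hY.aemeasurable, integral_const, probReal_univ, one_smul]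
  push_cast
  ring

/-- Dominated convergence. At t = 0 the quotient is 0 by convention, so no punctured neighbourhood
is needed. -/
lemma tendsto_integral_expRemainder (hY : IsStandardized Y P) :
    Tendsto (fun t : ℂ => ∫ ω, expRemainder (inner ℝ (Y ω) t) / (‖t‖ : ℂ) ^ 2 ∂P) (𝓝 0)
      (𝓝 0) := by
  have hi : ∀ (x t : ℂ), |(inner ℝ x t : ℝ)| ≤ ‖x‖ * ‖t‖ := fun x t => abs_real_inner_le_norm x t
  have h := tendsto_integral_filter_of_dominated_convergence (μ := P) (l := 𝓝 (0 : ℂ))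
    (F := fun t ω => expRemainder (inner ℝ (Y ω) t) / (‖t‖ : ℂ) ^ 2) (f := fun _ => 0)
    (fun ω => 4 * ‖Y ω‖ ^ 2) ?_ ?_ ?_ ?_
  · simpa using h
  · refine Eventually.of_forall fun t => ?_
    have : Continuous fun x : ℂ => expRemainder (inner ℝ x t) / (‖t‖ : ℂ) ^ 2 :=
      (continuous_expRemainder.comp (by fun_prop)).div_const _
    exact this.comp_aestronglyMeasurable hY.memLp.aestronglyMeasurable
  · refine Eventually.of_forall fun t => Eventually.of_forall fun ω => ?_
    rw [norm_div, norm_pow, norm_real, norm_norm]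
    refine div_le_of_le_mul₀ (by positivity) (by positivity) ((norm_expRemainder_le_sq _).trans ?_)
    have := pow_le_pow_left₀ (abs_nonneg _) (hi (Y ω) t) 2
    rw [sq_abs] at this
    nlinarith
  · exact hY.integrable_norm_sq.const_mul 4
  · refine Eventually.of_forall fun ω => ?_
    have h1 : Tendsto (fun t : ℂ => ‖Y ω‖ * ‖t‖) (𝓝 0) (𝓝 0) := by
      have : Continuous fun t : ℂ => ‖Y ω‖ * ‖t‖ := by fun_prop
      simpa using this.tendsto 0
    have h2 : Tendsto (fun t : ℂ => ‖Y ω‖ ^ 3 * ‖t‖) (𝓝 0) (𝓝 0) := by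
      have : Continuous fun t : ℂ => ‖Y ω‖ ^ 3 * ‖t‖ := by fun_prop
      simpa using this.tendsto 0
    refine squeeze_zero_norm' ?_ h2
    filter_upwards [h1.eventually_le_const one_pos] with t ht
    rw [norm_div, norm_pow, norm_real, norm_norm]
    refine div_le_of_le_mul₀ (by positivity) (by positivity)
      ((norm_expRemainder_le_cube ((hi _ _).trans ht)).trans ?_)
    refine (pow_le_pow_left₀ (abs_nonneg _) (hi (Y ω) t) 3).trans_eq ?_
    ring

/-- The characteristic function is `exp (-|t|² / 4) + o(|t|²)` at the origin. -/
lemma exists_norm_charFun_sub_exp_le [IsProbabilityMeasure P] (hY : IsStandardized Y P) {ε : ℝ}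
    (hε : 0 < ε) :
    ∃ δ > 0, ∀ t : ℂ, ‖t‖ ≤ δ →
      ‖charFun (P.map Y) t - (Real.exp (-(‖t‖ ^ 2 / 4)) : ℝ)‖ ≤ ε * ‖t‖ ^ 2 := by
  have h1 := (Metric.tendsto_nhds.mp hY.tendsto_integral_expRemainder) (ε / 2) (half_pos hε)
  obtain ⟨δ, hδ, h2⟩ := Metric.nhds_basis_closedBall.eventually_iff.mp h1
  -- The bounds 1 and ε give |t|² ≤ ε, so that |exp x - 1 - x| ≤ x² at x = -|t|²/4 costs at most
  -- (ε/2)|t|².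
  refine ⟨min δ (min 1 ε), by positivity, fun t ht => ?_⟩
  have hq : ‖charFun (P.map Y) t - (1 - ‖t‖ ^ 2 / 4 : ℝ)‖ ≤ ε / 2 * ‖t‖ ^ 2 := by
    rcases eq_or_ne t 0 with rfl | ht0
    · have : IsProbabilityMeasure (P.map Y) := Measure.isProbabilityMeasure_map hY.aemeasurable
      simp
    have h3 := h2 (show t ∈ Metric.closedBall 0 δ by simpa using ht.trans (min_le_left _ _))
    have h4 : 0 < ‖t‖ := norm_pos_iff.mpr ht0
    rw [dist_zero_right, integral_div, norm_div, norm_pow, norm_real, norm_norm,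
      div_lt_iff₀ (by positivity)] at h3
    rw [hY.charFun_sub_eq]
    exact h3.le
  have ht1 : ‖t‖ ≤ 1 := ht.trans ((min_le_right _ _).trans (min_le_left _ _))
  have hte : ‖t‖ ≤ ε := ht.trans ((min_le_right _ _).trans (min_le_right _ _))
  have ht2 : ‖t‖ ^ 2 ≤ 1 := pow_le_one₀ (norm_nonneg _) ht1
  have hx : |Real.exp (-(‖t‖ ^ 2 / 4)) - (1 - ‖t‖ ^ 2 / 4)| ≤ ε / 2 * ‖t‖ ^ 2 := by
    have h5 := Real.abs_exp_sub_one_sub_id_le (x := -(‖t‖ ^ 2 / 4))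
      (by rw [abs_neg, abs_of_nonneg (by positivity)]; linarith)
    rw [show Real.exp (-(‖t‖ ^ 2 / 4)) - (1 - ‖t‖ ^ 2 / 4) =
      Real.exp (-(‖t‖ ^ 2 / 4)) - 1 - -(‖t‖ ^ 2 / 4) by ring]
    refine h5.trans ?_
    have : ‖t‖ ^ 2 ≤ ε := by nlinarith [norm_nonneg t]
    nlinarith [sq_nonneg ‖t‖]
  calc _ = ‖(charFun (P.map Y) t - (1 - ‖t‖ ^ 2 / 4 : ℝ)) -
        ((Real.exp (-(‖t‖ ^ 2 / 4)) - (1 - ‖t‖ ^ 2 / 4) : ℝ) : ℂ)‖ := by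
        congr 1; push_cast; ring
    _ ≤ ε / 2 * ‖t‖ ^ 2 + ε / 2 * ‖t‖ ^ 2 := (norm_sub_le _ _).trans
        (add_le_add hq (by rw [norm_real]; exact hx))
    _ = ε * ‖t‖ ^ 2 := by ring

end IsStandardized

/-- Lindeberg's replacement: exchange the factors one at a time, the others having modulus at most
1. -/
lemma norm_prod_sub_prod_le_sum {ι : Type*} (s : Finset ι) {a b : ι → ℂ} (ha : ∀ i, ‖a i‖ ≤ 1)
    (hb : ∀ i, ‖b i‖ ≤ 1) : ‖∏ i ∈ s, a i - ∏ i ∈ s, b i‖ ≤ ∑ i ∈ s, ‖a i - b i‖ := by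
  classical
  induction s using Finset.induction_on with
  | empty => simp
  | insert i s hi ih =>
    rw [Finset.prod_insert hi, Finset.prod_insert hi, Finset.sum_insert hi]
    have e : a i * ∏ j ∈ s, a j - b i * ∏ j ∈ s, b j =
        (a i - b i) * ∏ j ∈ s, a j + b i * (∏ j ∈ s, a j - ∏ j ∈ s, b j) := by ring
    have h1 : ‖∏ j ∈ s, a j‖ ≤ 1 := by
      rw [norm_prod]
      exact Finset.prod_le_one (fun j _ => norm_nonneg _) fun j _ => ha j
    rw [e]
    refine (norm_add_le _ _).trans (add_le_add ?_ ?_)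
    · rw [norm_mul]
      exact mul_le_of_le_one_right (norm_nonneg _) h1
    · rw [norm_mul]
      exact (mul_le_of_le_one_left (norm_nonneg _) (hb i)).trans ih

/-- Complex weights can absorb the argument of the characteristic function, so scalar sums need only
be tested at 1. -/
lemma charFun_map_mul_const {Y : Ω → ℂ} (hY : AEMeasurable Y P) (b : ℂ) :
    charFun (P.map fun ω => b * Y ω) 1 = charFun (P.map Y) (conj b) := by
  rw [charFun_map_apply (hY.const_mul b), charFun_map_apply hY]
  refine integral_congr_ae (Eventually.of_forall fun ω => ?_)
  simp [Complex.inner, mul_comm]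

lemma charFun_map_sum_mul {ι : Type*} {X : ι → Ω → ℂ}
    (hX : ∀ n, AEMeasurable (X n) P) (hindep : iIndepFun X P) (b : ι → ℂ) (s : Finset ι) :
    charFun (P.map fun ω => ∑ n ∈ s, b n * X n ω) 1 =
      ∏ n ∈ s, charFun (P.map (X n)) (conj (b n)) := by
  have h1 : iIndepFun (fun n ω => b n * X n ω) P :=
    hindep.comp (fun n x => b n * x) fun n => measurable_const_mul (b n)
  have h2 := (h1.precomp (Subtype.val_injective (p := fun n => n ∈ s)))
  have h3 := iIndepFun.charFun_map_fun_finsetSum_eq_prod (s := s)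
    (X := fun n ω => b n * X n ω) (fun n _ => (hX n).const_mul _) h2
  rw [h3, Finset.prod_apply]
  exact Finset.prod_congr rfl fun n _ => charFun_map_mul_const (hX n) (b n)

lemma norm_charFun_map_le_one [IsProbabilityMeasure P] {Y : Ω → ℂ} (hY : AEMeasurable Y P) (t : ℂ) :
    ‖charFun (P.map Y) t‖ ≤ 1 := by
  have : IsProbabilityMeasure (P.map Y) := Measure.isProbabilityMeasure_map hY
  exact norm_charFun_le_one t

lemma tendsto_charFun_map [IsProbabilityMeasure P] {Y : ℕ → Ω → ℂ} {Z : Ω → ℂ}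
    (hY : ∀ n, AEMeasurable (Y n) P)
    (hZ : AEMeasurable Z P) (h : ∀ᵐ ω ∂P, Tendsto (fun n => Y n ω) atTop (𝓝 (Z ω))) (t : ℂ) :
    Tendsto (fun n => charFun (P.map (Y n)) t) atTop (𝓝 (charFun (P.map Z) t)) := by
  simp_rw [charFun_map_apply (hY _), charFun_map_apply hZ]
  have hc : Continuous fun x : ℂ => exp ((inner ℝ x t : ℝ) * I) := by fun_prop
  refine tendsto_integral_of_dominated_convergence (fun _ => 1)
    (fun n => hc.comp_aestronglyMeasurable (hY n).aestronglyMeasurable) (integrable_const _)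
    (fun n => Eventually.of_forall fun ω => by rw [norm_exp_ofReal_mul_I]) ?_
  filter_upwards [h] with ω hω
  exact (hc.tendsto _).comp hω

lemma aemeasurable_tsum_mul {X : ℕ → Ω → ℂ} (hX : ∀ n, AEMeasurable (X n) P) {b : ℕ → ℂ}
    (hs : ∀ᵐ ω ∂P, Summable fun n => b n * X n ω) :
    AEMeasurable (fun ω => ∑' n, b n * X n ω) P := by
  refine aemeasurable_of_tendsto_metrizable_ae atTop
    (f := fun (N : ℕ) ω => ∑ n ∈ Finset.range N, b n * X n ω)
    (fun N => Finset.aemeasurable_fun_sum _ fun n _ => (hX n).const_mul _) ?_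
  filter_upwards [hs] with ω hω
  exact hω.hasSum.tendsto_sum_nat

/-- Lindeberg's theorem for infinite weighted sums of i.i.d. variables, in quantitative form. -/
lemma exists_norm_charFun_tsum_sub_le [IsProbabilityMeasure P] {X : ℕ → Ω → ℂ}
    (hindep : iIndepFun X P)
    (hident : ∀ n, IdentDistrib (X n) (X 0) P P) (h0 : IsStandardized (X 0) P) {ε : ℝ}
    (hε : 0 < ε) : ∃ δ > 0, ∀ (b : ℕ → ℂ) (σ : ℝ), HasSum (fun n => ‖b n‖ ^ 2) σ →
      (∀ n, ‖b n‖ ≤ δ) → (∀ᵐ ω ∂P, Summable fun n => b n * X n ω) →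
      ‖charFun (P.map fun ω => ∑' n, b n * X n ω) 1 - (Real.exp (-(σ / 4)) : ℝ)‖ ≤ ε * σ := by
  obtain ⟨δ, hδ, h⟩ := h0.exists_norm_charFun_sub_exp_le hε
  have hX : ∀ n, AEMeasurable (X n) P := fun n => (hident n).aemeasurable_fst
  refine ⟨δ, hδ, fun b σ hσ hb hs => ?_⟩
  have h1 := tendsto_charFun_map
    (fun N => Finset.aemeasurable_fun_sum (Finset.range N) fun n _ => (hX n).const_mul (b n))
    (aemeasurable_tsum_mul hX hs) (hs.mono fun ω hω => hω.hasSum.tendsto_sum_nat) 1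
  have h2 := hσ.tendsto_sum_nat
  have h3 : Tendsto (fun N => ((Real.exp (-((∑ n ∈ Finset.range N, ‖b n‖ ^ 2) / 4)) : ℝ) : ℂ)) atTop
      (𝓝 ((Real.exp (-(σ / 4)) : ℝ) : ℂ)) := by
    have : Continuous fun x : ℝ => ((Real.exp (-(x / 4)) : ℝ) : ℂ) := by fun_prop
    exact (this.tendsto σ).comp h2
  -- The bound is proved for partial sums, where independence factorises the characteristic
  -- function, and then passed to the limit.
  refine le_of_tendsto_of_tendsto (h1.sub h3).norm (h2.const_mul ε)
    (Eventually.of_forall fun N => ?_)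
  simp only
  rw [charFun_map_sum_mul hX hindep, Finset.sum_div, ← Finset.sum_neg_distrib, Real.exp_sum,
    Complex.ofReal_prod, Finset.mul_sum]
  refine (norm_prod_sub_prod_le_sum _ (fun n => norm_charFun_map_le_one (hX n) _)
    fun n => ?_).trans (Finset.sum_le_sum fun n _ => ?_)
  · rw [norm_real, Real.norm_of_nonneg (Real.exp_pos _).le, Real.exp_le_one_iff]
    have := sq_nonneg ‖b n‖
    linarith
  · have := h (conj (b n)) (by rw [RCLike.norm_conj]; exact hb n)
    rw [RCLike.norm_conj] at this
    rw [(hident n).map_eq]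
    exact this

end CharFun

/-! ### The standard complex Gaussian law -/

section Gaussian

lemma charFun_stdComplexGaussian (t : ℂ) :
    charFun stdComplexGaussian t = (Real.exp (-(‖t‖ ^ 2 / 4)) : ℝ) := by
  have hm : Measurable fun z : ℂ => Real.toNNReal (Real.pi⁻¹ * Real.exp (-‖z‖ ^ 2)) := by fun_prop
  have h := GaussianFourier.integral_cexp_neg_mul_sq_norm_add (b := 1) (V := ℂ) (by simp)
    Complex.I t
  rw [charFun_apply, stdComplexGaussian]
  simp only [ENNReal.ofReal]
  rw [integral_withDensity_eq_integral_smul hm]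
  have e : ∀ z : ℂ, Real.toNNReal (Real.pi⁻¹ * Real.exp (-‖z‖ ^ 2)) •
      Complex.exp ((inner ℝ z t : ℝ) * Complex.I) =
      (Real.pi : ℂ)⁻¹ * Complex.exp (-1 * ‖z‖ ^ 2 + Complex.I * (inner ℝ t z : ℝ)) := by
    intro z
    rw [NNReal.smul_def, Real.coe_toNNReal _ (by positivity), Complex.real_smul, Complex.exp_add,
      real_inner_comm]
    push_cast
    ring_nf
  simp_rw [e]
  rw [integral_const_mul, h, Complex.finrank_real_complex]
  have hpi : (Real.pi : ℂ) ≠ 0 := by exact_mod_cast Real.pi_ne_zero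
  norm_num
  congr 1
  ring

lemma lintegral_enorm_stdComplexGaussian_lt_top :
    ∫⁻ z, ‖z‖ₑ ∂stdComplexGaussian < ∞ := by
  have hm : Measurable fun z : ℂ => ENNReal.ofReal (Real.pi⁻¹ * Real.exp (-‖z‖ ^ 2)) := by fun_prop
  rw [stdComplexGaussian, lintegral_withDensity_eq_lintegral_mul _ hm (by fun_prop)]
  have hi : Integrable (fun z : ℂ => Real.exp (-(1 / 2) * ‖z‖ ^ 2)) := by
    have := (GaussianFourier.integrable_cexp_neg_mul_sq_norm_add (b := 1 / 2) (V := ℂ)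
      (by norm_num) 0 0).re
    refine this.congr (Eventually.of_forall fun z => ?_)
    have : (-(1 / 2) * (‖z‖ : ℂ) ^ 2 + 0 * ((inner ℝ (0 : ℂ) z : ℝ) : ℂ)) =
      ((-(1 / 2) * ‖z‖ ^ 2 : ℝ) : ℂ) := by push_cast; ring
    simp only [this]
    exact Complex.exp_ofReal_re _
  refine lt_of_le_of_lt (lintegral_mono fun z => ?_) hi.lintegral_lt_top
  simp only [Pi.mul_apply]
  rw [← ofReal_norm, ← ENNReal.ofReal_mul (by positivity)]
  refine ENNReal.ofReal_le_ofReal ?_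
  have h1 : ‖z‖ ≤ Real.exp (1 / 2 * ‖z‖ ^ 2) := by
    have := Real.add_one_le_exp (1 / 2 * ‖z‖ ^ 2)
    nlinarith [sq_nonneg (‖z‖ - 1)]
  have h2 : Real.pi⁻¹ ≤ 1 := inv_le_one_of_one_le₀ (by linarith [Real.pi_gt_three])
  have h3 : Real.exp (-(1 / 2) * ‖z‖ ^ 2) =
      Real.exp (-‖z‖ ^ 2) * Real.exp (1 / 2 * ‖z‖ ^ 2) := by
    rw [← Real.exp_add]; congr 1; ring
  rw [h3]
  calc Real.pi⁻¹ * Real.exp (-‖z‖ ^ 2) * ‖z‖ ≤ 1 * Real.exp (-‖z‖ ^ 2) *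
      Real.exp (1 / 2 * ‖z‖ ^ 2) := by gcongr
    _ = _ := by ring

lemma stdComplexGaussian_singleton (z : ℂ) : stdComplexGaussian {z} = 0 :=
  (withDensity_absolutelyContinuous _ _) (by simp)

end Gaussian

/-! ### Random coefficients -/

section Moments

variable {Ω : Type*} [MeasurableSpace Ω] {P : Measure Ω}

/-- Bounded first moments give almost sure summability at one radius. Rational radii suffice, since
between s and ρ there is always a rational number. -/
lemma ae_admissible {κ : ℝ} (hκ : κ ≤ 0) {X : ℕ → Ω → ℂ} (hX : ∀ n, AEMeasurable (X n) P)
    {C : ℝ≥0∞} (hC : C ≠ ∞) (hXC : ∀ n, ∫⁻ ω, ‖X n ω‖ₑ ∂P ≤ C) :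
    ∀ᵐ ω ∂P, Admissible κ fun n => X n ω := by
  have key : ∀ q : ℚ, 0 ≤ (q : ℝ) → 0 < 1 + κ * (q : ℝ) ^ 2 →
      ∀ᵐ ω ∂P, Summable fun n => ‖X n ω‖ * (coeff κ n * (q : ℝ) ^ n) := by
    intro q hq hq'
    have hs := summable_coeff_mul_pow hκ hq hq'
    have hpos : ∀ n, 0 ≤ coeff κ n * (q : ℝ) ^ n := fun n =>
      mul_nonneg (coeff_pos hκ n).le (pow_nonneg hq n)
    have hm : ∀ n, AEMeasurable
        (fun ω => ‖X n ω‖ₑ * ENNReal.ofReal (coeff κ n * (q : ℝ) ^ n)) P :=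
      fun n => (hX n).enorm.mul_const _
    have h1 : ∫⁻ ω, ∑' n, ‖X n ω‖ₑ * ENNReal.ofReal (coeff κ n * (q : ℝ) ^ n) ∂P ≠ ∞ := by
      rw [lintegral_tsum hm]
      refine ne_top_of_le_ne_top (ENNReal.mul_ne_top hC hs.tsum_ofReal_ne_top) ?_
      rw [← ENNReal.tsum_mul_left]
      refine ENNReal.tsum_le_tsum fun n => ?_
      rw [lintegral_mul_const'' _ (hX n).enorm]
      gcongr
      exact hXC n
    filter_upwards [ae_lt_top' (AEMeasurable.tsum hm) h1] with ω hω
    have h2 := ENNReal.summable_toReal hω.ne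
    refine h2.congr fun n => ?_
    rw [ENNReal.toReal_mul, toReal_enorm, ENNReal.toReal_ofReal (hpos n)]
  have hall : ∀ᵐ ω ∂P, ∀ q : ℚ, 0 ≤ (q : ℝ) → 0 < 1 + κ * (q : ℝ) ^ 2 →
      Summable fun n => ‖X n ω‖ * (coeff κ n * (q : ℝ) ^ n) := by
    rw [ae_all_iff]
    intro q
    by_cases h : 0 ≤ (q : ℝ) ∧ 0 < 1 + κ * (q : ℝ) ^ 2
    · filter_upwards [key q h.1 h.2] with ω hω _ _ using hω
    · exact Eventually.of_forall fun ω h1 h2 => absurd ⟨h1, h2⟩ h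
  filter_upwards [hall] with ω hω s hs hs'
  obtain ⟨r, hsr, hr⟩ := exists_gt_one_add_mul_sq_pos hs'
  obtain ⟨q, hq1, hq2⟩ := exists_rat_btwn hsr
  have hq0 : 0 ≤ (q : ℝ) := hs.trans hq1.le
  refine Summable.of_nonneg_of_le (fun n => ?_) (fun n => ?_)
    (hω q hq0 (one_add_mul_sq_pos_of_le hκ hq0 hq2.le hr))
  · have := coeff_pos hκ n
    positivity
  · have := coeff_pos hκ n
    gcongr

lemma integral_mul_conj_eq {X : ℕ → Ω → ℂ} (hindep : iIndepFun X P)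
    (hident : ∀ n, IdentDistrib (X n) (X 0) P P) (h0 : IsStandardized (X 0) P) (n m : ℕ) :
    ∫ ω, X n ω * conj (X m ω) ∂P = if n = m then 1 else 0 := by
  split_ifs with h
  · subst h
    have h1 : ∫ ω, X n ω * conj (X n ω) ∂P = ((∫ ω, ‖X n ω‖ ^ 2 ∂P : ℝ) : ℂ) := by
      rw [← integral_complex_ofReal]
      refine integral_congr_ae (Eventually.of_forall fun ω => ?_)
      simp [Complex.mul_conj']
    have h2 : ∫ ω, ‖X n ω‖ ^ 2 ∂P = ∫ ω, ‖X 0 ω‖ ^ 2 ∂P :=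
      ((hident n).comp (u := fun x : ℂ => ‖x‖ ^ 2) (by fun_prop)).integral_eq
    rw [h1, h2, h0.var, Complex.ofReal_one]
  · have hi := hindep.indepFun h
    have hi' : IndepFun (X n) (fun ω => conj (X m ω)) P :=
      hi.comp measurable_id (Complex.continuous_conj.measurable)
    rw [hi'.integral_fun_mul_eq_mul_integral (hident n).aemeasurable_fst.aestronglyMeasurable
      (Complex.continuous_conj.comp_aestronglyMeasurable
        (hident m).aemeasurable_fst.aestronglyMeasurable), (hident n).integral_eq, h0.mean,
      zero_mul]

lemma integral_norm_sum_sq {X : ℕ → Ω → ℂ} (hindep : iIndepFun X P)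
    (hident : ∀ n, IdentDistrib (X n) (X 0) P P) (h0 : IsStandardized (X 0) P) (b : ℕ → ℂ)
    (s : Finset ℕ) : ∫ ω, ‖∑ n ∈ s, b n * X n ω‖ ^ 2 ∂P = ∑ n ∈ s, ‖b n‖ ^ 2 := by
  have hL : ∀ n, MemLp (X n) 2 P := fun n => (hident n).memLp_iff.mpr h0.memLp
  have hint : ∀ n m, Integrable (fun ω => (b n * conj (b m)) * (X n ω * conj (X m ω))) P :=
    fun n m => ((hL n).integrable_mul (hL m).star).const_mul _
  have h1 : ((∫ ω, ‖∑ n ∈ s, b n * X n ω‖ ^ 2 ∂P : ℝ) : ℂ) = ((∑ n ∈ s, ‖b n‖ ^ 2 : ℝ) : ℂ) := by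
    rw [← integral_complex_ofReal]
    have e : ∀ ω, ((‖∑ n ∈ s, b n * X n ω‖ ^ 2 : ℝ) : ℂ) =
        ∑ n ∈ s, ∑ m ∈ s, (b n * conj (b m)) * (X n ω * conj (X m ω)) := by
      intro ω
      rw [Complex.ofReal_pow, ← Complex.mul_conj', map_sum, Finset.sum_mul_sum]
      refine Finset.sum_congr rfl fun n _ => Finset.sum_congr rfl fun m _ => ?_
      rw [map_mul]
      ring
    simp_rw [e]
    rw [integral_finsetSum _ fun n _ => integrable_finsetSum _ fun m _ => hint n m]
    push_cast
    refine Finset.sum_congr rfl fun n hn => ?_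
    rw [integral_finsetSum _ fun m _ => hint n m]
    simp_rw [integral_const_mul, integral_mul_conj_eq hindep hident h0]
    simp [hn, Complex.mul_conj']
  exact_mod_cast h1

/-- Fatou's lemma along the partial sums, whose second moments are ∑|b_n|² by orthogonality; then x
≤ 1 + x². -/
lemma lintegral_enorm_tsum_le [IsProbabilityMeasure P] {X : ℕ → Ω → ℂ} (hindep : iIndepFun X P)
    (hident : ∀ n, IdentDistrib (X n) (X 0) P P) (h0 : IsStandardized (X 0) P) {b : ℕ → ℂ} {σ : ℝ}
    (hσ : HasSum (fun n => ‖b n‖ ^ 2) σ) (hs : ∀ᵐ ω ∂P, Summable fun n => b n * X n ω) :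
    ∫⁻ ω, ‖∑' n, b n * X n ω‖ₑ ∂P ≤ ENNReal.ofReal (1 + σ) := by
  have hX : ∀ n, AEMeasurable (X n) P := fun n => (hident n).aemeasurable_fst
  have hL : ∀ n, MemLp (X n) 2 P := fun n => (hident n).memLp_iff.mpr h0.memLp
  have hm : ∀ N, AEMeasurable (fun ω => ∑ n ∈ Finset.range N, b n * X n ω) P := fun N =>
    Finset.aemeasurable_fun_sum _ fun n _ => (hX n).const_mul _
  have h1 : ∫⁻ ω, ‖∑' n, b n * X n ω‖ₑ ∂P =
      ∫⁻ ω, liminf (fun N => ‖∑ n ∈ Finset.range N, b n * X n ω‖ₑ) atTop ∂P := by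
    refine lintegral_congr_ae ?_
    filter_upwards [hs] with ω hω
    exact (hω.hasSum.tendsto_sum_nat.enorm.liminf_eq).symm
  rw [h1]
  refine (lintegral_liminf_le' fun N => (hm N).enorm).trans ?_
  refine liminf_le_of_le (by isBoundedDefault) fun c hc => ?_
  obtain ⟨N, hN⟩ := hc.exists
  refine hN.trans ?_
  have hS : MemLp (fun ω => ∑ n ∈ Finset.range N, b n * X n ω) 2 P :=
    memLp_finsetSum _ fun n _ => (hL n).const_mul _
  have hI : Integrable (fun ω => 1 + ‖∑ n ∈ Finset.range N, b n * X n ω‖ ^ 2) P :=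
    (integrable_const _).add hS.norm.integrable_sq
  calc ∫⁻ ω, ‖∑ n ∈ Finset.range N, b n * X n ω‖ₑ ∂P
      ≤ ∫⁻ ω, ENNReal.ofReal (1 + ‖∑ n ∈ Finset.range N, b n * X n ω‖ ^ 2) ∂P := by
        refine lintegral_mono fun ω => ?_
        rw [← ofReal_norm]
        refine ENNReal.ofReal_le_ofReal ?_
        nlinarith [sq_nonneg (‖∑ n ∈ Finset.range N, b n * X n ω‖ - 1)]
    _ = ENNReal.ofReal (∫ ω, (1 + ‖∑ n ∈ Finset.range N, b n * X n ω‖ ^ 2) ∂P) :=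
        (ofReal_integral_eq_lintegral_ofReal hI (Eventually.of_forall fun ω => by positivity)).symm
    _ ≤ ENNReal.ofReal (1 + σ) := by
        refine ENNReal.ofReal_le_ofReal ?_
        rw [integral_add (integrable_const _) hS.norm.integrable_sq, integral_const, probReal_univ,
          one_smul, integral_norm_sum_sq hindep hident h0]
        gcongr
        exact sum_le_hasSum _ (fun n _ => by positivity) hσ

end Moments

/-! ### Convergence of the finite-dimensional marginals -/

section Marginals

/-- Pythagoras for the orthonormal rows: linear combinations of the new coefficients have a variance
independent of v. -/
lemma hasSum_norm_sum_mul_transition_sq {κ : ℝ} (hκ : κ ≤ 0) {v : ℂ} (hv : 0 < 1 + κ * ‖v‖ ^ 2)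
    {m : ℕ} (c : Fin m → ℂ) :
    HasSum (fun n => ‖∑ k : Fin m, c k * transition κ v k n‖ ^ 2) (∑ k, ‖c k‖ ^ 2) := by
  rw [← Complex.hasSum_ofReal]
  have h : HasSum (fun n => ∑ j : Fin m, ∑ k : Fin m,
      c j * conj (c k) * (transition κ v j n * conj (transition κ v k n)))
      (∑ j : Fin m, ∑ k : Fin m, c j * conj (c k) * (if (j : ℕ) = k then 1 else 0)) :=
    hasSum_sum fun j _ => hasSum_sum fun k _ => (hasSum_transition_mul_conj hκ hv j k).mul_left _
  have e : ∑ j : Fin m, ∑ k : Fin m, c j * conj (c k) * (if (j : ℕ) = k then 1 else 0) =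
      ((∑ k, ‖c k‖ ^ 2 : ℝ) : ℂ) := by
    simp [← Fin.ext_iff, Complex.mul_conj']
  rw [← e]
  refine h.congr_fun fun n => ?_
  rw [Complex.ofReal_pow, ← Complex.mul_conj', map_sum, Finset.sum_mul_sum]
  refine Finset.sum_congr rfl fun j _ => Finset.sum_congr rfl fun k _ => ?_
  rw [map_mul]
  ring

variable {Ω : Type*} [MeasurableSpace Ω] {P : Measure Ω}

lemma aemeasurable_toLp {m : ℕ} {Y : Fin m → Ω → ℂ} (hY : ∀ k, AEMeasurable (Y k) P) :
    AEMeasurable (fun ω => (WithLp.toLp 2 fun k => Y k ω : EuclideanSpace ℂ (Fin m))) P :=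
  (PiLp.continuous_toLp 2 fun _ : Fin m => ℂ).measurable.comp_aemeasurable
    (aemeasurable_pi_lambda _ hY)

lemma charFun_map_toLp {m : ℕ} {Y : Fin m → Ω → ℂ} (hY : ∀ k, AEMeasurable (Y k) P)
    (t : EuclideanSpace ℂ (Fin m)) :
    charFun (P.map fun ω => (WithLp.toLp 2 fun k => Y k ω : EuclideanSpace ℂ (Fin m))) t =
      charFun (P.map fun ω => ∑ k, conj (t k) * Y k ω) 1 := by
  rw [charFun_map_apply (Finset.aemeasurable_fun_sum _ fun k _ => (hY k).const_mul _),
    charFun_apply,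
    integral_map (aemeasurable_toLp hY) (by
      exact (by fun_prop : Continuous fun x : EuclideanSpace ℂ (Fin m) =>
        Complex.exp ((inner ℝ x t : ℝ) * Complex.I)).aestronglyMeasurable)]
  refine integral_congr_ae (Eventually.of_forall fun ω => ?_)
  simp only [PiLp.inner_apply, sum_inner]
  congr 4
  ext k
  simp [Complex.inner, mul_comm]

lemma ae_admissible_of_identDistrib [IsProbabilityMeasure P] {κ : ℝ} (hκ : κ ≤ 0)
    {X : ℕ → Ω → ℂ} (hident : ∀ n, IdentDistrib (X n) (X 0) P P) (h0 : MemLp (X 0) 2 P) :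
    ∀ᵐ ω ∂P, Admissible κ fun n => X n ω :=
  ae_admissible hκ (fun n => (hident n).aemeasurable_fst)
    (h0.integrable one_le_two).hasFiniteIntegral.ne
    fun n => (((hident n).comp (u := fun x : ℂ => ‖x‖ₑ) (by fun_prop)).lintegral_eq).le

/-- By the Cramér–Wold device it suffices to treat ∑_k conj(t_k) Y_k. This is a weighted sum of the
X_n whose weights have constant ℓ² norm and sup norm tending to 0, so Lindeberg's theorem applies.
-/
theorem tendstoInDistribution_marginals [IsProbabilityMeasure P] {Ω' : Type*}
    [MeasurableSpace Ω'] {P' : Measure Ω'} [IsProbabilityMeasure P'] {κ : ℝ} (hκ : κ ≤ 0)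
    {X : ℕ → Ω → ℂ} (hindep : iIndepFun X P) (hident : ∀ n, IdentDistrib (X n) (X 0) P P)
    (h0 : IsStandardized (X 0) P) {Z : ℕ → Ω' → ℂ} (hZ : iIndepFun Z P')
    (hZl : ∀ n, HasLaw (Z n) stdComplexGaussian P') (m : ℕ) :
    TendstoInDistribution (fun (u : disk κ) ω =>
        (WithLp.toLp 2 fun k : Fin m => transport κ (-(u : ℂ)) (fun n => X n ω) k :
          EuclideanSpace ℂ (Fin m)))
      (toBoundary κ)
      (fun ω' => (WithLp.toLp 2 fun k : Fin m => Z k ω' : EuclideanSpace ℂ (Fin m)))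
      (fun _ => P) P' := by
  have hX : ∀ n, AEMeasurable (X n) P := fun n => (hident n).aemeasurable_fst
  have hu : ∀ u : disk κ, 0 < 1 + κ * ‖-(u : ℂ)‖ ^ 2 := fun u => by
    rw [norm_neg]; exact (mem_disk_iff hκ).mp u.2
  have hadm := ae_admissible_of_identDistrib hκ hident h0.memLp
  have hs : ∀ (u : disk κ) k, ∀ᵐ ω ∂P, Summable fun n => transition κ (-(u : ℂ)) k n * X n ω :=
    fun u k => hadm.mono fun ω hω => summable_transition_mul hκ (hu u) hω k
  have hc : ∀ (u : disk κ) k,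
      AEMeasurable (fun ω => transport κ (-(u : ℂ)) (fun n => X n ω) k) P :=
    fun u k => aemeasurable_tsum_mul hX (hs u k)
  have hZm : ∀ k, AEMeasurable (Z k) P' := fun k => (hZl k).aemeasurable
  refine ⟨fun u => aemeasurable_toLp fun k => hc u k, aemeasurable_toLp fun k => hZm k, ?_⟩
  -- Lévy's continuity theorem is applied along sequences.
  suffices key : ∀ t : EuclideanSpace ℂ (Fin m), Tendsto (fun u : disk κ => charFun (P.map fun ω =>
      (WithLp.toLp 2 fun k : Fin m => transport κ (-(u : ℂ)) (fun n => X n ω) k :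
          EuclideanSpace ℂ (Fin m))) t) (toBoundary κ) (𝓝 (charFun (P'.map fun ω' =>
      (WithLp.toLp 2 fun k : Fin m => Z k ω' : EuclideanSpace ℂ (Fin m))) t)) from
    tendsto_of_seq_tendsto fun us hus =>
      ProbabilityMeasure.tendsto_iff_tendsto_charFun.mpr fun t => (key t).comp hus
  intro t
  set σ : ℝ := ∑ k, ‖t k‖ ^ 2 with hσ
  have hlim : charFun (P'.map fun ω' =>
      (WithLp.toLp 2 fun k : Fin m => Z k ω' : EuclideanSpace ℂ (Fin m))) t =
      (Real.exp (-(σ / 4)) : ℝ) := by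
    rw [charFun_map_toLp (fun k : Fin m => hZm k),
      charFun_map_sum_mul (X := fun k : Fin m => Z k) (fun k => hZm k)
        (hZ.precomp Fin.val_injective)]
    simp_rw [(hZl _).map_eq, charFun_stdComplexGaussian]
    rw [← Complex.ofReal_prod, ← Real.exp_sum, hσ, Finset.sum_neg_distrib, Finset.sum_div]
    simp
  rw [hlim]
  have hchar : ∀ u : disk κ, charFun (P.map fun ω =>
      (WithLp.toLp 2 fun k : Fin m => transport κ (-(u : ℂ)) (fun n => X n ω) k :
          EuclideanSpace ℂ (Fin m))) t =
      charFun (P.map fun ω => ∑' n, (∑ k : Fin m, conj (t k) * transition κ (-(u : ℂ)) k n) *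
        X n ω) 1 := by
    intro u
    rw [charFun_map_toLp fun k : Fin m => hc u k]
    congr 1
    refine Measure.map_congr ?_
    filter_upwards [hadm] with ω hω
    simp_rw [transport, ← tsum_mul_left, Finset.sum_mul, mul_assoc]
    exact (Summable.tsum_finsetSum fun (k : Fin m) _ =>
      (summable_transition_mul hκ (hu u) hω k).mul_left (conj (t k))).symm
  simp_rw [hchar]
  have hσ0 : 0 ≤ σ := Finset.sum_nonneg fun k _ => by positivity
  rw [Metric.tendsto_nhds]
  intro ε hε
  -- The Lindeberg error is this constant times σ, hence below ε; the 1 guards against σ = 0.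
  obtain ⟨δ, hδ, H⟩ := exists_norm_charFun_tsum_sub_le hindep hident h0
    (ε := ε / (2 * (σ + 1))) (by positivity)
  have hsmall : ∀ᶠ u : disk κ in toBoundary κ, ∀ k : Fin m, ∀ n,
      ‖transition κ (-(u : ℂ)) k n‖ ≤ δ / (∑ k, ‖t k‖ + 1) :=
    eventually_all.mpr fun k => eventually_norm_transition_le hκ k
      (div_pos hδ (add_pos_of_nonneg_of_pos (Finset.sum_nonneg fun k _ => norm_nonneg _) one_pos))
  filter_upwards [hsmall] with u hi
  rw [dist_eq_norm]
  have hsum : HasSum (fun n => ‖∑ k : Fin m, conj (t k) * transition κ (-(u : ℂ)) k n‖ ^ 2) σ := by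
    have := hasSum_norm_sum_mul_transition_sq hκ (hu (u)) fun k => conj (t k)
    simpa only [RCLike.norm_conj] using this
  refine (H _ σ hsum (fun n => ?_) ?_).trans_lt ?_
  · have hpos : 0 < ∑ k, ‖t k‖ + 1 :=
      add_pos_of_nonneg_of_pos (Finset.sum_nonneg fun k _ => norm_nonneg _) one_pos
    calc ‖∑ k : Fin m, conj (t k) * transition κ (-(u : ℂ)) k n‖
        ≤ ∑ k : Fin m, ‖t k‖ * (δ / (∑ k, ‖t k‖ + 1)) := by
          refine norm_sum_le_of_le _ fun k _ => ?_
          rw [norm_mul, RCLike.norm_conj]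
          exact mul_le_mul_of_nonneg_left (hi k n) (norm_nonneg _)
      _ = (∑ k, ‖t k‖) * (δ / (∑ k, ‖t k‖ + 1)) := (Finset.sum_mul ..).symm
      _ ≤ δ := by
          rw [mul_div_assoc', div_le_iff₀ hpos]
          nlinarith
  · filter_upwards [hadm] with ω hω
    simp_rw [Finset.sum_mul, mul_assoc]
    exact summable_sum fun k _ => (summable_transition_mul hκ (hu (u)) hω k).mul_left _
  · rw [div_mul_eq_mul_div, div_lt_iff₀ (by positivity)]
    nlinarith

end Marginals

/-! ### Two criteria for convergence in distribution -/

section Criteria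

variable {Ω Ω' ι E F : Type*} [MeasurableSpace Ω] [MeasurableSpace Ω'] {P : Measure Ω}
  [IsProbabilityMeasure P] {P' : Measure Ω'} [IsProbabilityMeasure P'] {l : Filter ι}
  [l.IsCountablyGenerated]

lemma edist_integral_comp_le [PseudoEMetricSpace E] [MeasurableSpace E] [OpensMeasurableSpace E]
    {f : E → ℝ} {L : NNReal} (hL : LipschitzWith L f) {B : ℝ} (hB : ∀ x, ‖f x‖ ≤ B) {Y Y' : Ω → E}
    (hY : AEMeasurable Y P) (hY' : AEMeasurable Y' P) :
    edist (∫ x, f x ∂P.map Y) (∫ x, f x ∂P.map Y') ≤ L * ∫⁻ ω, edist (Y ω) (Y' ω) ∂P := by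
  have hm : ∀ {Q : Measure E}, AEStronglyMeasurable f Q :=
    fun {Q} => hL.continuous.measurable.aestronglyMeasurable
  have hi : ∀ {W : Ω → E}, AEMeasurable W P → Integrable (fun ω => f (W ω)) P := fun hW =>
    Integrable.of_bound (hm.comp_aemeasurable hW) B (Eventually.of_forall fun ω => hB _)
  rw [integral_map hY hm, integral_map hY' hm, edist_eq_enorm_sub, ← integral_sub (hi hY) (hi hY'),
    ← lintegral_const_mul' _ _ ENNReal.coe_ne_top]
  refine (enorm_integral_le_lintegral_enorm _).trans (lintegral_mono fun ω => ?_)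
  rw [← edist_eq_enorm_sub]
  exact hL _ _

/-- Convergence in distribution of random variables which are approximated, uniformly in mean,
by families converging in distribution. -/
theorem tendstoInDistribution_of_lintegral_edist_le [PseudoEMetricSpace E] [MeasurableSpace E]
    [OpensMeasurableSpace E] {Y : ι → Ω → E} {Z : Ω' → E} {Y' : ℕ → ι → Ω → E} {Z' : ℕ → Ω' → E}
    (hY : ∀ i, AEMeasurable (Y i) P) (hZ : AEMeasurable Z P')
    (h : ∀ m, TendstoInDistribution (Y' m) l (Z' m) (fun _ => P) P') {τ : ℕ → ℝ≥0∞}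
    (hτ : Tendsto τ atTop (𝓝 0)) (hYτ : ∀ m i, ∫⁻ ω, edist (Y i ω) (Y' m i ω) ∂P ≤ τ m)
    (hZτ : ∀ m, ∫⁻ ω, edist (Z' m ω) (Z ω) ∂P' ≤ τ m) :
    TendstoInDistribution Y l Z (fun _ => P) P' := by
  refine ⟨hY, hZ, tendsto_iff_forall_lipschitz_integral_tendsto.mpr ?_⟩
  rintro f ⟨C, hC⟩ ⟨L, hL⟩
  obtain ⟨ω₀⟩ : Nonempty Ω' := nonempty_of_isProbabilityMeasure P'
  have hB : ∀ x, ‖f x‖ ≤ ‖f (Z ω₀)‖ + C := fun x => by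
    have := hC x (Z ω₀)
    rw [dist_eq_norm] at this
    have h2 := norm_sub_norm_le (f x) (f (Z ω₀))
    linarith
  rw [EMetric.tendsto_nhds]
  intro ε hε
  have hLτ : Tendsto (fun m => (L : ℝ≥0∞) * τ m) atTop (𝓝 0) := by
    simpa using ENNReal.Tendsto.const_mul hτ (Or.inr ENNReal.coe_ne_top)
  have hε3 : 0 < ε / 3 := ENNReal.div_pos hε.ne' (by norm_num)
  obtain ⟨m, hm⟩ := (hLτ.eventually_lt_const hε3).exists
  have h1 := tendsto_iff_forall_lipschitz_integral_tendsto.mp (h m).tendsto f ⟨C, hC⟩ ⟨L, hL⟩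
  filter_upwards [(EMetric.tendsto_nhds.mp h1) (ε / 3) hε3] with i hi
  calc edist (∫ x, f x ∂P.map (Y i)) (∫ x, f x ∂P'.map Z)
      ≤ edist (∫ x, f x ∂P.map (Y i)) (∫ x, f x ∂P.map (Y' m i)) +
        edist (∫ x, f x ∂P.map (Y' m i)) (∫ x, f x ∂P'.map (Z' m)) +
        edist (∫ x, f x ∂P'.map (Z' m)) (∫ x, f x ∂P'.map Z) := edist_triangle4 _ _ _ _
    _ < ε / 3 + ε / 3 + ε / 3 := by
        refine ENNReal.add_lt_add (ENNReal.add_lt_add ?_ hi) ?_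
        · refine (edist_integral_comp_le hL hB (hY i) ((h m).forall_aemeasurable i)).trans_lt ?_
          exact (mul_le_mul_right (hYτ m i) _).trans_lt hm
        · refine (edist_integral_comp_le hL hB (h m).aemeasurable_limit hZ).trans_lt ?_
          exact (mul_le_mul_right (hZτ m) _).trans_lt hm
    _ = ε := ENNReal.add_thirds ε

/-- The continuous mapping theorem for a map which is continuous away from a point which is
not charged by the limit law. -/
theorem tendstoInDistribution_comp_of_continuousOn_compl_singleton [TopologicalSpace E] [T1Space E]
    [HasOuterApproxClosed E] [MeasurableSpace E] [BorelSpace E] [TopologicalSpace F]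
    [MeasurableSpace F] [BorelSpace F] [HasOuterApproxClosed F]
    {Y : ι → Ω → E} {Z : Ω' → E} (h : TendstoInDistribution Y l Z (fun _ => P) P') {a : E}
    {T : E → F} (hT : ContinuousOn T {a}ᶜ) (ha : P'.map Z {a} = 0) :
    TendstoInDistribution (fun i ω => T (Y i ω)) l (fun ω => T (Z ω)) (fun _ => P) P' := by
  have hTm : Measurable T := measurable_of_continuousOn_compl_singleton a hT
  have hYm := fun i => h.forall_aemeasurable i
  have hTY : ∀ i, AEMeasurable (fun ω => T (Y i ω)) P := fun i => hTm.comp_aemeasurable (hYm i)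
  have hTZ : AEMeasurable (fun ω => T (Z ω)) P' := hTm.comp_aemeasurable h.aemeasurable_limit
  refine ⟨hTY, hTZ, ?_⟩
  refine tendsto_of_forall_isClosed_limsup_le' fun C hC => ?_
  -- The preimage of C need not be closed, but adding the exceptional point makes it so, at no cost
  -- in the limit measure. The portmanteau theorem then applies.
  have hcl : IsClosed (T ⁻¹' C ∪ {a}) := by
    rw [← isOpen_compl_iff]
    have := hT.isOpen_inter_preimage isOpen_compl_singleton hC.isOpen_compl
    convert! this using 1
    ext x
    simp
  have h1 := ProbabilityMeasure.limsup_measure_closed_le_of_tendsto h.tendsto hcl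
  simp only [ProbabilityMeasure.coe_mk] at h1 ⊢
  have hCm := hTm hC.measurableSet
  calc limsup (fun i => P.map (fun ω => T (Y i ω)) C) l
      ≤ limsup (fun i => P.map (Y i) (T ⁻¹' C ∪ {a})) l := by
        refine limsup_le_limsup (Eventually.of_forall fun i => ?_)
        dsimp only
        rw [Measure.map_apply_of_aemeasurable (hTY i) hC.measurableSet,
          Measure.map_apply_of_aemeasurable (hYm i) (hCm.union (measurableSet_singleton a))]
        exact measure_mono fun ω hω => Or.inl hω
    _ ≤ P'.map Z (T ⁻¹' C ∪ {a}) := h1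
    _ ≤ P'.map Z (T ⁻¹' C) + P'.map Z {a} := measure_union_le _ _
    _ = P'.map (fun ω => T (Z ω)) C := by
        rw [ha, add_zero, Measure.map_apply_of_aemeasurable hTZ hC.measurableSet,
          Measure.map_apply_of_aemeasurable h.aemeasurable_limit hCm]
        rfl

end Criteria

/-! ### The space of absolutely summable coefficients -/

section SeqSpace

/-- The Banach space of absolutely summable complex sequences. -/
noncomputable abbrev SeqSpace := lp (fun _ : ℕ => ℂ) 1

noncomputable instance : MeasurableSpace SeqSpace := borel _

instance : BorelSpace SeqSpace := ⟨rfl⟩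

lemma hasSum_norm_seqSpace (y : SeqSpace) : HasSum (fun k => ‖y k‖) ‖y‖ := by
  simpa using lp.hasSum_norm (p := 1) (by simp) y

/-- The element of the sequence space with the coefficients `w_k c_k`, if these are summable. -/
noncomputable def ofCoeffs (w : ℕ → ℂ) (c : ℕ → ℂ) : SeqSpace :=
  open Classical in
  if h : Memℓp (fun k => w k * c k) 1 then (⟨fun k => w k * c k, h⟩ : SeqSpace) else 0

lemma ofCoeffs_apply {w c : ℕ → ℂ} (h : Summable fun k => ‖w k * c k‖) (k : ℕ) :
    ofCoeffs w c k = w k * c k := by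
  have h' : Memℓp (fun k => w k * c k) 1 := memℓp_gen (by simpa using h)
  rw [ofCoeffs, dif_pos h']

/-- The element of the sequence space with the first coefficients `w_k v_k`, followed by zeros. -/
noncomputable def ofFin (w : ℕ → ℂ) {m : ℕ} (v : EuclideanSpace ℂ (Fin m)) : SeqSpace :=
  ∑ k : Fin m, lp.single 1 (k : ℕ) (w k * v k)

lemma continuous_ofFin (w : ℕ → ℂ) (m : ℕ) :
    Continuous (ofFin w : EuclideanSpace ℂ (Fin m) → SeqSpace) :=
  continuous_finsetSum _ fun k _ =>
    (lp.isometry_single (E := fun _ : ℕ => ℂ) (p := 1) (k : ℕ)).continuous.comp (by fun_prop)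

lemma hasSum_single_ofCoeffs {w c : ℕ → ℂ} (h : Summable fun k => ‖w k * c k‖) :
    HasSum (fun k => (lp.single 1 k (w k * c k) : SeqSpace)) (ofCoeffs w c) := by
  have := lp.hasSum_single (p := 1) ENNReal.one_ne_top (ofCoeffs w c)
  simpa only [ofCoeffs_apply h] using this

lemma ofFin_toLp (w c : ℕ → ℂ) (m : ℕ) : ofFin w (WithLp.toLp 2 fun k : Fin m => c k) =
    ∑ k ∈ Finset.range m, (lp.single 1 k (w k * c k) : SeqSpace) :=
  Fin.sum_univ_eq_sum_range (fun k => (lp.single 1 k (w k * c k) : SeqSpace)) m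

lemma edist_ofCoeffs_ofFin_le {w c : ℕ → ℂ} (h : Summable fun k => ‖w k * c k‖) (m : ℕ) :
    edist (ofCoeffs w c) (ofFin w (WithLp.toLp 2 fun k : Fin m => c k)) ≤
      ∑' k, ‖w (k + m)‖ₑ * ‖c (k + m)‖ₑ := by
  have hs := hasSum_single_ofCoeffs h
  rw [ofFin_toLp, edist_eq_enorm_sub, ← hs.tsum_eq, ← hs.summable.sum_add_tsum_nat_add m,
    add_sub_cancel_left]
  refine enorm_tsum_le_tsum_enorm.trans (ENNReal.tsum_le_tsum fun k => ?_)
  rw [← enorm_mul, ← ofReal_norm, ← ofReal_norm, lp.norm_single one_pos]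

variable {Ω Ω' ι : Type*} [MeasurableSpace Ω] [MeasurableSpace Ω'] {P : Measure Ω}

lemma aemeasurable_ofCoeffs {w : ℕ → ℂ} {c : ℕ → Ω → ℂ} (hc : ∀ k, AEMeasurable (c k) P)
    (hs : ∀ᵐ ω ∂P, Summable fun k => ‖w k * c k ω‖) :
    AEMeasurable (fun ω => ofCoeffs w fun k => c k ω) P := by
  refine aemeasurable_of_tendsto_metrizable_ae atTop (f := fun (m : ℕ) ω =>
    ofFin w (WithLp.toLp 2 fun k : Fin m => c k ω)) (fun m =>
    (continuous_ofFin w m).measurable.comp_aemeasurable (aemeasurable_toLp fun k => hc k)) ?_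
  filter_upwards [hs] with ω hω
  simp_rw [ofFin_toLp w fun k => c k ω]
  exact (hasSum_single_ofCoeffs hω).tendsto_sum_nat

lemma lintegral_edist_ofCoeffs_ofFin_le {w : ℕ → ℂ} {c : ℕ → Ω → ℂ}
    (hc : ∀ k, AEMeasurable (c k) P) (hs : ∀ᵐ ω ∂P, Summable fun k => ‖w k * c k ω‖) {C : ℝ≥0∞}
    (hC : ∀ k, ∫⁻ ω, ‖c k ω‖ₑ ∂P ≤ C) (m : ℕ) :
    ∫⁻ ω, edist (ofCoeffs w fun k => c k ω)
      (ofFin w (WithLp.toLp 2 fun k : Fin m => c k ω)) ∂P ≤ ∑' k, ‖w (k + m)‖ₑ * C := by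
  refine (lintegral_mono_ae (hs.mono fun ω hω => edist_ofCoeffs_ofFin_le hω m)).trans ?_
  rw [lintegral_tsum fun k => (hc (k + m)).enorm.const_mul _]
  refine ENNReal.tsum_le_tsum fun k => ?_
  rw [lintegral_const_mul'' _ (hc (k + m)).enorm]
  gcongr
  exact hC _

variable [IsProbabilityMeasure P] {P' : Measure Ω'} [IsProbabilityMeasure P'] {l : Filter ι}
  [l.IsCountablyGenerated]

/-- Convergence in distribution in the sequence space follows from convergence of the
finite-dimensional marginals and a uniform bound for the moments. -/
theorem tendstoInDistribution_ofCoeffs {w : ℕ → ℂ} (hw : Summable fun k => ‖w k‖)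
    {c : ι → ℕ → Ω → ℂ} {d : ℕ → Ω' → ℂ}
    (hcs : ∀ i, ∀ᵐ ω ∂P, Summable fun k => ‖w k * c i k ω‖)
    (hds : ∀ᵐ ω ∂P', Summable fun k => ‖w k * d k ω‖)
    (hc : ∀ i k, AEMeasurable (c i k) P) (hd : ∀ k, AEMeasurable (d k) P') {C : ℝ≥0∞} (hC : C ≠ ∞)
    (hcC : ∀ i k, ∫⁻ ω, ‖c i k ω‖ₑ ∂P ≤ C) (hdC : ∀ k, ∫⁻ ω, ‖d k ω‖ₑ ∂P' ≤ C)
    (h : ∀ m, TendstoInDistribution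
      (fun i ω => (WithLp.toLp 2 fun k : Fin m => c i k ω : EuclideanSpace ℂ (Fin m))) l
      (fun ω => (WithLp.toLp 2 fun k : Fin m => d k ω : EuclideanSpace ℂ (Fin m)))
      (fun _ => P) P') :
    TendstoInDistribution (fun i ω => ofCoeffs w fun k => c i k ω) l
      (fun ω => ofCoeffs w fun k => d k ω) (fun _ => P) P' := by
  refine tendstoInDistribution_of_lintegral_edist_le
    (Y' := fun m i ω => ofFin w (WithLp.toLp 2 fun k : Fin m => c i k ω))
    (Z' := fun m ω => ofFin w (WithLp.toLp 2 fun k : Fin m => d k ω))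
    (τ := fun m => ∑' k, ‖w (k + m)‖ₑ * C)
    (fun i => aemeasurable_ofCoeffs (hc i) (hcs i)) (aemeasurable_ofCoeffs hd hds)
    (fun m => (h m).continuous_comp (g := ofFin w) (continuous_ofFin w m)) ?_
    (fun m i => lintegral_edist_ofCoeffs_ofFin_le (hc i) (hcs i) (hcC i) m) fun m => ?_
  · refine ENNReal.tendsto_sum_nat_add (fun k => ‖w k‖ₑ * C) ?_
    rw [ENNReal.tsum_mul_right]
    refine ENNReal.mul_ne_top ?_ hC
    simp_rw [← ofReal_norm]
    exact hw.tsum_ofReal_ne_top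
  · simp_rw [edist_comm (ofFin w _)]
    exact lintegral_edist_ofCoeffs_ofFin_le hd hds hdC m

end SeqSpace

/-! ### Linear statistics of zeros as functions on the sequence space -/

section Statistic

variable {κ r : ℝ}

/-- Dividing by a_k r^k makes y the coefficient sequence in powers of z/r, so the series converges
absolutely up to |z| = r. -/
lemma hasSum_powerSeriesFun_seqSpace (hκ : κ ≤ 0) (hr : 0 < r) (y : SeqSpace) {z : ℂ}
    (hz : ‖z‖ ≤ r) :
    HasSum (fun k => y k * (z / r) ^ k)
      (powerSeriesFun κ (fun k => y k / (coeff κ k * r ^ k)) z) := by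
  have hs : Summable fun k => y k * (z / r) ^ k := by
    refine Summable.of_norm_bounded (hasSum_norm_seqSpace y).summable fun k => ?_
    rw [norm_mul, norm_pow, norm_div, Complex.norm_of_nonneg hr.le]
    exact mul_le_of_le_one_right (norm_nonneg _)
      (pow_le_one₀ (by positivity) ((div_le_one hr).mpr hz))
  have e : ∀ k, (coeff κ k : ℂ) * (y k / (coeff κ k * r ^ k)) * z ^ k = y k * (z / r) ^ k := by
    intro k
    have h1 : (coeff κ k : ℂ) ≠ 0 := by exact_mod_cast (coeff_pos hκ k).ne'
    have h2 : (r : ℂ) ≠ 0 := by exact_mod_cast hr.ne'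
    rw [div_pow]
    field_simp
  rw [powerSeriesFun, tsum_congr e]
  exact hs.hasSum

lemma analyticOnNhd_powerSeriesFun_seqSpace (hκ : κ ≤ 0) (hr : 0 < r) (y : SeqSpace) :
    AnalyticOnNhd ℂ (powerSeriesFun κ fun k => y k / (coeff κ k * r ^ k)) (Metric.ball 0 r) := by
  refine DifferentiableOn.analyticOnNhd ?_ Metric.isOpen_ball
  have h : DifferentiableOn ℂ (fun z : ℂ => ∑' k, y k * (z / r) ^ k) (Metric.ball 0 r) := by
    refine Complex.differentiableOn_tsum_of_summable_norm (hasSum_norm_seqSpace y).summable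
      (fun k => by fun_prop) Metric.isOpen_ball fun k z hz => ?_
    rw [norm_mul, norm_pow, norm_div, Complex.norm_of_nonneg hr.le]
    exact mul_le_of_le_one_right (norm_nonneg _)
      (pow_le_one₀ (by positivity) ((div_le_one hr).mpr (mem_ball_zero_iff.mp hz).le))
  exact h.congr fun z hz =>
    ((hasSum_powerSeriesFun_seqSpace hκ hr y (mem_ball_zero_iff.mp hz).le).tsum_eq).symm

lemma norm_powerSeriesFun_sub_le (hκ : κ ≤ 0) (hr : 0 < r) (y y' : SeqSpace) {z : ℂ}
    (hz : ‖z‖ ≤ r) :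
    ‖powerSeriesFun κ (fun k => y k / (coeff κ k * r ^ k)) z -
      powerSeriesFun κ (fun k => y' k / (coeff κ k * r ^ k)) z‖ ≤ ‖y - y'‖ := by
  have h := (hasSum_powerSeriesFun_seqSpace hκ hr y hz).sub
    (hasSum_powerSeriesFun_seqSpace hκ hr y' hz)
  refine h.norm_le_of_bounded (hasSum_norm_seqSpace (y - y')) fun k => ?_
  rw [← sub_mul, norm_mul, norm_pow, norm_div, Complex.norm_of_nonneg hr.le]
  exact mul_le_of_le_one_right (norm_nonneg _)
      (pow_le_one₀ (by positivity) ((div_le_one hr).mpr hz))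

lemma exists_powerSeriesFun_ne_zero (hκ : κ ≤ 0) (hr : 0 < r) {y : SeqSpace} (hy : y ≠ 0) :
    ∃ z ∈ Metric.ball (0 : ℂ) r, powerSeriesFun κ (fun k => y k / (coeff κ k * r ^ k)) z ≠ 0 := by
  by_contra! h
  have hr0 : (r : ℂ) ≠ 0 := by exact_mod_cast hr.ne'
  have e := eq_of_hasSum_mul_pow (c := fun k => y k / (r : ℂ) ^ k) (d := 0) (f := fun _ => 0) hr
    (fun z hz => by
      rw [← h z (mem_ball_zero_iff.mpr hz)]
      refine (hasSum_powerSeriesFun_seqSpace hκ hr y hz.le).congr_fun fun k => ?_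
      rw [div_pow]
      field_simp)
    (fun z hz => by simp)
  refine hy (lp.ext (funext fun k => ?_))
  have := congrFun e k
  simpa [hr0] using this

/-- Convergence in ℓ¹ is uniform convergence on the disk of radius r. The zero sequence is excluded
because the Hurwitz argument needs a limit that is not identically zero. -/
theorem continuousOn_linearStatistic_seqSpace (hκ : κ ≤ 0) (hr : 0 < r) {φ : ℂ → ℂ}
    (hφ : Continuous φ) (hφc : HasCompactSupport φ) (hφd : tsupport φ ⊆ disk κ)
    (hφr : tsupport φ ⊆ Metric.ball 0 r) :
    ContinuousOn (fun y : SeqSpace => linearStatistic κ (fun k => y k / (coeff κ k * r ^ k)) φ)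
      {0}ᶜ := by
  intro y hy
  refine ContinuousAt.continuousWithinAt ?_
  rw [ContinuousAt]
  simp_rw [linearStatistic_eq_finsum hφd]
  refine tendsto_finsum_analyticOrderNatAt_mul (R := r)
    (fun y => analyticOnNhd_powerSeriesFun_seqSpace hκ hr y)
    (analyticOnNhd_powerSeriesFun_seqSpace hκ hr y) (exists_powerSeriesFun_ne_zero hκ hr hy) ?_
    hφ hφc hφr
  rw [Metric.tendstoUniformlyOn_iff]
  intro ε hε
  filter_upwards [Metric.ball_mem_nhds y hε] with y' hy' z hz
  rw [dist_eq_norm]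
  refine (norm_powerSeriesFun_sub_le hκ hr y y' (mem_ball_zero_iff.mp hz).le).trans_lt ?_
  rwa [← dist_eq_norm, dist_comm]

lemma exists_pos_tsupport_subset_ball (hκ : κ ≤ 0) {φ : ℂ → ℂ} (hφc : HasCompactSupport φ)
    (hφd : tsupport φ ⊆ disk κ) :
    ∃ r, 0 < r ∧ 0 < 1 + κ * r ^ 2 ∧ tsupport φ ⊆ Metric.ball 0 r := by
  rcases (tsupport φ).eq_empty_or_nonempty with h | h
  · obtain ⟨r, hr, hr'⟩ := exists_gt_one_add_mul_sq_pos (κ := κ) (s := 0) (by simp)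
    exact ⟨r, hr, hr', by simp [h]⟩
  · obtain ⟨z, hz, hmax⟩ := hφc.isCompact.exists_isMaxOn h continuous_norm.continuousOn
    obtain ⟨r, hr, hr'⟩ := exists_gt_one_add_mul_sq_pos ((mem_disk_iff hκ).mp (hφd hz))
    exact ⟨r, (norm_nonneg z).trans_lt hr, hr', fun x hx =>
      mem_ball_zero_iff.mpr ((hmax hx).trans_lt hr)⟩

lemma Admissible.summable_norm_weight_mul {x : ℕ → ℂ} (hx : Admissible κ x) (hκ : κ ≤ 0)
    (hr : 0 < r) (hr' : 0 < 1 + κ * r ^ 2) :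
    Summable fun k => ‖(coeff κ k * r ^ k : ℂ) * x k‖ := by
  refine (hx r hr.le hr').congr fun k => ?_
  rw [norm_mul, norm_mul, norm_pow, Complex.norm_of_nonneg hr.le,
    Complex.norm_of_nonneg (coeff_pos hκ k).le, mul_comm]

lemma linearStatistic_ofCoeffs {x : ℕ → ℂ} (hx : Admissible κ x) (hκ : κ ≤ 0)
    (hr : 0 < r) (hr' : 0 < 1 + κ * r ^ 2) (φ : ℂ → ℂ) :
    linearStatistic κ (fun k => ofCoeffs (fun k => coeff κ k * r ^ k) x k / (coeff κ k * r ^ k)) φ =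
      linearStatistic κ x φ := by
  congr 1
  ext k
  rw [ofCoeffs_apply (hx.summable_norm_weight_mul hκ hr hr')]
  have h1 : (coeff κ k : ℂ) ≠ 0 := by exact_mod_cast (coeff_pos hκ k).ne'
  have h2 : (r : ℂ) ≠ 0 := by exact_mod_cast hr.ne'
  field_simp

end Statistic

end RandomAnalytic

open RandomAnalytic

theorem theorem1
    {Ω Ω' : Type*} [MeasurableSpace Ω] [MeasurableSpace Ω']
    (P : Measure Ω) [IsProbabilityMeasure P]
    (P' : Measure Ω') [IsProbabilityMeasure P']
    -- i.i.d. coefficients with mean zero and unit variance, whose real and imaginary parts are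
    -- uncorrelated with equal variances
    (X : ℕ → Ω → ℂ)
    (hX_indep : iIndepFun X P)
    (hX_ident : ∀ n, IdentDistrib (X n) (X 0) P P)
    (hX_memLp : MemLp (X 0) 2 P)
    (hX_mean : ∫ ω, X 0 ω ∂P = 0)
    (hX_var : ∫ ω, ‖X 0 ω‖ ^ 2 ∂P = 1)
    (hX_re_im : ∫ ω, (X 0 ω).re ^ 2 ∂P = ∫ ω, (X 0 ω).im ^ 2 ∂P)
    (hX_uncorr : ∫ ω, (X 0 ω).re * (X 0 ω).im ∂P = 0)
    -- i.i.d. standard complex Gaussian coefficients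
    (Z : ℕ → Ω' → ℂ)
    (hZ_indep : iIndepFun Z P')
    (hZ_law : ∀ n, HasLaw (Z n) RandomAnalytic.stdComplexGaussian P')
    (κ : ℝ) (hκ : κ ≤ 0)
    (φ : ℂ → ℂ) (hφ_cont : Continuous φ) (hφ_compact : HasCompactSupport φ)
    (hφ_support : tsupport φ ⊆ RandomAnalytic.disk κ) :
    TendstoInDistribution
      (fun (u : RandomAnalytic.disk κ) (ω : Ω) =>
        RandomAnalytic.linearStatistic κ (fun n => X n ω)
          (fun ξ => φ (RandomAnalytic.mobius κ u ξ)))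
      (RandomAnalytic.toBoundary κ)
      (fun ω' : Ω' => RandomAnalytic.linearStatistic κ (fun n => Z n ω') φ)
      (fun _ => P) P' := by
  have h0 : IsStandardized (X 0) P := ⟨hX_memLp, hX_mean, hX_var, hX_re_im, hX_uncorr⟩
  obtain ⟨r, hr, hr', hφr⟩ := exists_pos_tsupport_subset_ball hκ hφ_compact hφ_support
  have hu : ∀ u : disk κ, 0 < 1 + κ * ‖(u : ℂ)‖ ^ 2 := fun u => (mem_disk_iff hκ).mp u.2
  have hu' : ∀ u : disk κ, 0 < 1 + κ * ‖-(u : ℂ)‖ ^ 2 := fun u => by rw [norm_neg]; exact hu u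
  have hXadm := ae_admissible_of_identDistrib hκ hX_ident hX_memLp
  have hZm : ∀ k, AEMeasurable (Z k) P' := fun k => (hZ_law k).aemeasurable
  have hZC : ∀ k, ∫⁻ ω, ‖Z k ω‖ₑ ∂P' = ∫⁻ z, ‖z‖ₑ ∂stdComplexGaussian := fun k => by
    rw [← (hZ_law k).map_eq, lintegral_map' (by fun_prop) (hZm k)]
  have hZadm := ae_admissible hκ hZm lintegral_enorm_stdComplexGaussian_lt_top.ne
    fun k => (hZC k).le
  have hs : ∀ (u : disk κ) k, ∀ᵐ ω ∂P, Summable fun n => transition κ (-(u : ℂ)) k n * X n ω :=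
    fun u k => hXadm.mono fun ω hω => summable_transition_mul hκ (hu' u) hω k
  have hc : ∀ (u : disk κ) k,
      AEMeasurable (fun ω => transport κ (-(u : ℂ)) (fun n => X n ω) k) P :=
    fun u k => aemeasurable_tsum_mul (fun n => (hX_ident n).aemeasurable_fst) (hs u k)
  have hcC : ∀ (u : disk κ) k, ∫⁻ ω, ‖transport κ (-(u : ℂ)) (fun n => X n ω) k‖ₑ ∂P ≤
      ENNReal.ofReal (1 + 1) := by
    intro u k
    refine lintegral_enorm_tsum_le hX_indep hX_ident h0 ?_ (hs u k)
    rw [← Complex.hasSum_ofReal]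
    simpa [Complex.mul_conj'] using hasSum_transition_mul_conj hκ (hu' u) k k
  have hw : Summable fun k => ‖(coeff κ k * r ^ k : ℂ)‖ := by
    refine (summable_coeff_mul_pow hκ hr.le hr').congr fun k => ?_
    rw [norm_mul, norm_pow, Complex.norm_of_nonneg hr.le,
      Complex.norm_of_nonneg (coeff_pos hκ k).le]
  have hlim := tendstoInDistribution_ofCoeffs (l := toBoundary κ) hw
    (c := fun u k ω => transport κ (-(u : ℂ)) (fun n => X n ω) k) (d := Z)
    (C := max (ENNReal.ofReal (1 + 1)) (∫⁻ z, ‖z‖ₑ ∂stdComplexGaussian))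
    (fun u => hXadm.mono fun ω hω =>
      (admissible_transport hκ (hu' u) hω).summable_norm_weight_mul hκ hr hr')
    (hZadm.mono fun ω hω => hω.summable_norm_weight_mul hκ hr hr') hc hZm
    (max_lt ENNReal.ofReal_lt_top lintegral_enorm_stdComplexGaussian_lt_top).ne
    (fun u k => (hcC u k).trans (le_max_left _ _)) (fun k => (hZC k).le.trans (le_max_right _ _))
    (tendstoInDistribution_marginals hκ hX_indep hX_ident h0 hZ_indep hZ_law)
  -- The coordinate at index 0 is Z_0, as a_0 = 1, and the law of Z_0 has no atoms.
  have hzero : P'.map (fun ω => ofCoeffs (fun k => coeff κ k * r ^ k) fun k => Z k ω) {0} = 0 := by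
    rw [Measure.map_apply_of_aemeasurable hlim.aemeasurable_limit (measurableSet_singleton 0)]
    have h1 : P' (Z 0 ⁻¹' {0}) = 0 := by
      rw [← Measure.map_apply_of_aemeasurable (hZm 0) (measurableSet_singleton 0),
        (hZ_law 0).map_eq, stdComplexGaussian_singleton]
    refine measure_mono_null_ae ?_ h1
    filter_upwards [hZadm] with ω hω h
    have h2 := ofCoeffs_apply (hω.summable_norm_weight_mul hκ hr hr') 0
    rw [show ofCoeffs (fun k => coeff κ k * r ^ k) (fun k => Z k ω) = 0 from h] at h2
    change Z 0 ω = 0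
    simpa [coeff_zero] using h2.symm
  -- Almost surely the coefficients are admissible, so the map on ℓ¹ returns the actual zero
  -- statistics, and the transported one equals the sum of φ ∘ Φ^u over the zeros of the original
  -- series.
  refine (tendstoInDistribution_comp_of_continuousOn_compl_singleton hlim
    (continuousOn_linearStatistic_seqSpace hκ hr hφ_cont hφ_compact hφ_support hφr)
    hzero).congr (fun u => ?_) ?_
  · filter_upwards [hXadm] with ω hω
    rw [linearStatistic_ofCoeffs (admissible_transport hκ (hu' u) hω) hκ hr hr',
      linearStatistic_comp_mobius hκ (hu u) hω]
  · filter_upwards [hZadm] with ω hω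
    exact linearStatistic_ofCoeffs hω hκ hr hr' φ
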